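/- **Conventions.** PA is Peano arithmetic in the language $\langle 0,1,+,\cdot,\le\rangle$, with axioms $0\ne z+1$; $x+1=y+1\to x=y$; $x+0=x$; $x+(y+1)=(x+y)+1$; $x\le y\leftrightarrow\exists z\,(x+z=y)$; $x\cdot 0=0$; $x(y+1)=xy+x$; and induction for all formulas. For a set $\kappa$ of indices, $\mathrm{LA}_\kappa$ ($\kappa$-linear arithmetic) is the theory in the language $\langle 0,1,+,\le,a_i\rangle_{i\in\kappa}$, with the $a_i$ unary function symbols, whose axioms are the five axioms above on $0,1,+,\le$, the axioms $a_i(x+1)=a_ix+a_i1$ and $a_i(a_jx)=a_j(a_ix)$, and induction for all formulas of this language. $\mathrm{LA}^\#_\kappa$ (strict $\kappa$-linear arithmetic) is $\mathrm{LA}_\kappa$ together with the scheme: no $a_i$ is definable, even with parameters, by a formula not containing $a_i$. For $M\models\mathrm{PA}$ and $a,b\in M$, let $\langle M^+,a,b\rangle$ be the additive reduct $\langle M,0,1,+,\le\rangle$ expanded by the unary functions $x\mapsto ax$ and $x\mapsto bx$. A formula in its language is *$b$-bounded* if all its quantifiers are of the form $\exists x<b1$ or $\forall x<b1$. An element of $M$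 is *non-standard* if it is not the value of a numeral $0,\,0+1,\,(0+1)+1,\dots$; $M$ is non-standard if it has a non-standard element. **Theorem 3.1.** Let $M$ be a non-standard model of PA and let $L\in M$. 1. There are elements $a<b$ in $M$ such that $\langle M^+,a,b\rangle\models\mathrm{LA}_2$ and the graph of multiplication restricted to $[0,L]^2$, that is $\{(x,y,z)\in M^3: x\le L,\ y\le L,\ z=x\cdot y\}$, is defined in $\langle M^+,a,b\rangle$ by a $b$-bounded formula without parameters. 2. If $L$ is non-standard, then the segment $[0,L]$ is infinite, and for all $a<b$ in $M$ such that the multiplication restricted to $[0,L]^2$ is definable in $\langle M^+,a,b\rangle$ by a $b$-bounded formula without parameters (in particular for those given by 1), $\langle M^+,a,b\rangle\models\mathrm{LA}^\#_2$. -/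

import Mathlib

open FirstOrder FirstOrder.Language

namespace LinArith

/-! ### Arithmetical languages and the axioms common to all arithmetical theories -/

/-- A language with distinguished symbols `0`, `1`, `+`, `≤`. -/
class IsArithmetical (L : FirstOrder.Language.{0, 0}) extends L.IsOrdered where
  zeroSymb : L.Functions 0
  oneSymb : L.Functions 0
  addSymb : L.Functions 2

section Terms

variable {L : FirstOrder.Language.{0, 0}} [IsArithmetical L] {α : Type*}

/-- The term `0`. -/
def tZero : L.Term α := Constants.term IsArithmetical.zeroSymb

/-- The term `1`. -/
def tOne : L.Term α := Constants.term IsArithmetical.oneSymb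

/-- The term `s + t`. -/
def tAdd (s t : L.Term α) : L.Term α := Functions.apply₂ IsArithmetical.addSymb s t

end Terms

/-- The variable `&i` in a sentence under `n` quantifiers (the `i`-th quantifier from outside). -/
def bv (L : FirstOrder.Language.{0, 0}) {n : ℕ} (i : Fin n) : L.Term (Empty ⊕ Fin n) := Term.var (Sum.inr i)

section Axioms

variable (L : FirstOrder.Language.{0, 0}) [IsArithmetical L]

/-- (A1) `∀ z, 0 ≠ z + 1`. -/
def axA1 : L.Sentence := ∀' ∼(tZero =' tAdd (bv L 0) tOne)

/-- (A2) `∀ x y, x + 1 = y + 1 → x = y`. -/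
def axA2 : L.Sentence :=
  ∀' ∀' ((tAdd (bv L 0) tOne =' tAdd (bv L 1) tOne) ⟹ (bv L 0 =' bv L 1))

/-- (A3) `∀ x, x + 0 = x`. -/
def axA3 : L.Sentence := ∀' (tAdd (bv L 0) tZero =' bv L 0)

/-- (A4) `∀ x y, x + (y + 1) = (x + y) + 1`. -/
def axA4 : L.Sentence :=
  ∀' ∀' (tAdd (bv L 0) (tAdd (bv L 1) tOne) =' tAdd (tAdd (bv L 0) (bv L 1)) tOne)

/-- (D) `∀ x y, x ≤ y ↔ ∃ z, x + z = y`. -/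
def axD : L.Sentence :=
  ∀' ∀' (((bv L 0).le (bv L 1)) ⇔ ∃' (tAdd (bv L 0) (bv L 2) =' bv L 1))

variable {L}

/-- The universal closure of a formula with free variables indexed by `Fin n`. -/
noncomputable def univClosure {n : ℕ} (φ : L.Formula (Fin n)) : L.Sentence :=
  Formula.iAlls (Fin n) (φ.relabel Sum.inr : L.Formula (Empty ⊕ Fin n))

/-- For `φ(ȳ, x)`, with parameters `ȳ` indexed by `Fin n` and induction variable `x`, and a term
`t(ȳ, x)` : the formula `φ(ȳ, t)`. -/
def substLast {n : ℕ} {β : Type} (φ : L.Formula (Fin n ⊕ Fin 1)) (ys : Fin n → L.Term β)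
    (t : L.Term β) : L.Formula β :=
  BoundedFormula.subst φ (Sum.elim ys fun _ => t)

/-- The induction axiom for `φ(ȳ, x)`:
`∀ ȳ, φ(ȳ, 0) ∧ (∀ x, φ(ȳ, x) → φ(ȳ, x + 1)) → ∀ x, φ(ȳ, x)`. -/
noncomputable def axInd {n : ℕ} (φ : L.Formula (Fin n ⊕ Fin 1)) : L.Sentence :=
  univClosure
    ((substLast φ Term.var tZero ⊓
        Formula.iAlls (Fin 1)
          (φ ⟹ substLast φ (fun i => Term.var (Sum.inl i))
            (tAdd (Term.var (Sum.inr 0)) tOne))) ⟹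
      Formula.iAlls (Fin 1) φ)

variable (L)

/-- The axioms (A1)-(A4), (D) and the full induction scheme for the language `L`. -/
def arithTheory : L.Theory :=
  {axA1 L, axA2 L, axA3 L, axA4 L, axD L} ∪ ⋃ n : ℕ, Set.range (axInd (L := L) (n := n))

end Axioms

/-! ### Peano arithmetic -/

/-- Function symbols `0, 1, +, ·`. -/
inductive PeanoFunc : ℕ → Type
  | zero : PeanoFunc 0
  | one : PeanoFunc 0
  | add : PeanoFunc 2
  | mul : PeanoFunc 2

/-- The relation symbol `≤`. -/
inductive LeRel : ℕ → Type
  | le : LeRel 2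

/-- The language `⟨0, 1, +, ·, ≤⟩`. -/
def peano : FirstOrder.Language.{0, 0} := ⟨PeanoFunc, LeRel⟩

instance : IsArithmetical peano where
  leSymb := LeRel.le
  zeroSymb := PeanoFunc.zero
  oneSymb := PeanoFunc.one
  addSymb := PeanoFunc.add

/-- The term `s · t`. -/
def tMul {α : Type*} (s t : peano.Term α) : peano.Term α :=
  Functions.apply₂ (L := peano) PeanoFunc.mul s t

/-- `∀ x, x · 0 = 0`. -/
def axMulZero : peano.Sentence := ∀' (tMul (bv peano 0) tZero =' tZero)

/-- `∀ x y, x · (y + 1) = x · y + x`. -/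
def axMulSucc : peano.Sentence :=
  ∀' ∀' (tMul (bv peano 0) (tAdd (bv peano 1) tOne) =' tAdd (tMul (bv peano 0) (bv peano 1)) (bv peano 0))

/-- Peano arithmetic. -/
def PA : peano.Theory := arithTheory peano ∪ {axMulZero, axMulSucc}

/-- Any type with operations `0, 1, +, ·` and a relation `≤` is a structure for the language of
Peano arithmetic (and every structure for that language arises so). -/
instance peanoStructure (M : Type*) [Zero M] [One M] [Add M] [Mul M] [LE M] :
    peano.Structure M where
  funMap {n} (f : PeanoFunc n) :=
    match n, f with
    | _, .zero => fun _ => 0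
    | _, .one => fun _ => 1
    | _, .add => fun v => v 0 + v 1
    | _, .mul => fun v => v 0 * v 1
  RelMap {n} (r : LeRel n) :=
    match n, r with
    | _, .le => fun v => v 0 ≤ v 1

/-! ### Linear arithmetics -/

/-- Function symbols `0, 1, +` and a unary function symbol for each `i : κ`. -/
inductive LinFunc (κ : Type) : ℕ → Type
  | zero : LinFunc κ 0
  | one : LinFunc κ 0
  | add : LinFunc κ 2
  | scalar (i : κ) : LinFunc κ 1

/-- The language `⟨0, 1, +, ≤, aᵢ⟩` with `i : κ` of `κ`-linear arithmetic. -/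
def lin (κ : Type) : FirstOrder.Language.{0, 0} := ⟨LinFunc κ, LeRel⟩

instance (κ : Type) : IsArithmetical (lin κ) where
  leSymb := LeRel.le
  zeroSymb := LinFunc.zero
  oneSymb := LinFunc.one
  addSymb := LinFunc.add

/-- The term `aᵢ t`. -/
def tScalar {κ : Type} {α : Type*} (i : κ) (t : (lin κ).Term α) : (lin κ).Term α :=
  Functions.apply₁ (L := lin κ) (LinFunc.scalar i) t

/-- (L1) `∀ x, aᵢ (x + 1) = aᵢ x + aᵢ 1`. -/
def axL1 {κ : Type} (i : κ) : (lin κ).Sentence :=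
  ∀' (tScalar i (tAdd (bv (lin κ) 0) tOne) =' tAdd (tScalar i (bv (lin κ) 0)) (tScalar i tOne))

/-- (L2) `∀ x, aᵢ (aⱼ x) = aⱼ (aᵢ x)`. -/
def axL2 {κ : Type} (i j : κ) : (lin κ).Sentence :=
  ∀' (tScalar i (tScalar j (bv (lin κ) 0)) =' tScalar j (tScalar i (bv (lin κ) 0)))

/-- `κ`-linear arithmetic. -/
def LA (κ : Type) : (lin κ).Theory :=
  arithTheory (lin κ) ∪ Set.range (axL1 (κ := κ)) ∪ Set.range fun p : κ × κ => axL2 p.1 p.2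

/-- The inclusion of the language without the symbol `aᵢ` into `lin κ`. -/
def omitScalar {κ : Type} (i : κ) : lin {j : κ // j ≠ i} →ᴸ lin κ where
  onFunction {n} (f : LinFunc {j : κ // j ≠ i} n) :=
    match n, f with
    | _, .zero => LinFunc.zero
    | _, .one => LinFunc.one
    | _, .add => LinFunc.add
    | _, .scalar j => LinFunc.scalar j.1
  onRelation _ r := r

/-- For a formula `φ(p̄, x, y)` not containing the symbol `aᵢ` (with parameters `p̄` indexed by
`Fin n` and `(x, y)` indexed by `Fin 2`): the sentence
`∀ p̄, ¬ ∀ x y, (aᵢ x = y ↔ φ(p̄, x, y))`, saying that `φ` does not define `aᵢ`. -/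
noncomputable def axStrict {κ : Type} (i : κ) {n : ℕ}
    (φ : (lin {j : κ // j ≠ i}).Formula (Fin n ⊕ Fin 2)) : (lin κ).Sentence :=
  univClosure
    (∼(Formula.iAlls (Fin 2)
      ((Term.equal (tScalar i (Term.var (Sum.inr 0))) (Term.var (Sum.inr 1))).iff
        ((omitScalar i).onFormula φ))))

/-- Strictly `κ`-linear arithmetic: no `aᵢ` is definable (even with parameters) by a formula that
does not contain `aᵢ`. -/
def LAStrict (κ : Type) : (lin κ).Theory :=
  LA κ ∪ ⋃ (i : κ) (n : ℕ), Set.range (axStrict i (n := n))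

/-- The structure `⟨M⁺, s⟩`: the additive part of `M` expanded by the unary functions `x ↦ sᵢ · x`. -/
@[reducible] def scalarStructure {κ : Type} {M : Type*} [Zero M] [One M] [Add M] [Mul M] [LE M]
    (s : κ → M) : (lin κ).Structure M where
  funMap {n} (f : LinFunc κ n) :=
    match n, f with
    | _, .zero => fun _ => 0
    | _, .one => fun _ => 1
    | _, .add => fun v => v 0 + v 1
    | _, .scalar i => fun v => s i * v 0
  RelMap {n} (r : LeRel n) :=
    match n, r with
    | _, .le => fun v => v 0 ≤ v 1

/-! ### Bounded formulas and definability of a segment of multiplication -/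

/-- A formula is `aᵢ`-bounded if all its quantifiers are of the form `∀ x < aᵢ 1` or
`∃ x < aᵢ 1`. -/
inductive ScalarBounded {κ : Type} (i : κ) {α : Type} :
    ∀ {n : ℕ}, (lin κ).BoundedFormula α n → Prop
  | falsum {n : ℕ} : ScalarBounded i (BoundedFormula.falsum (n := n))
  | equal {n : ℕ} (s t : (lin κ).Term (α ⊕ Fin n)) : ScalarBounded i (BoundedFormula.equal s t)
  | rel {n l : ℕ} (R : (lin κ).Relations l) (ts : Fin l → (lin κ).Term (α ⊕ Fin n)) :
      ScalarBounded i (BoundedFormula.rel R ts)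
  | imp {n : ℕ} {φ ψ : (lin κ).BoundedFormula α n} (hφ : ScalarBounded i φ)
      (hψ : ScalarBounded i ψ) : ScalarBounded i (φ ⟹ ψ)
  | ball {n : ℕ} {φ : (lin κ).BoundedFormula α (n + 1)} (hφ : ScalarBounded i φ) :
      ScalarBounded i
        (∀' (Term.lt (Term.var (Sum.inr (Fin.last n))) (tScalar i tOne) ⟹ φ))
  | bex {n : ℕ} {φ : (lin κ).BoundedFormula α (n + 1)} (hφ : ScalarBounded i φ) :
      ScalarBounded i
        (∃' (Term.lt (Term.var (Sum.inr (Fin.last n))) (tScalar i tOne) ⊓ φ))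

section Statement

variable {M : Type*} [Zero M] [One M] [Add M] [Mul M] [LE M]

/-- `x` is not the value of a numeral. -/
def IsNonstandard (x : M) : Prop := ∀ n : ℕ, x ≠ Nat.unaryCast n

/-- The graph of multiplication restricted to `[0, L]²` is `∅`-definable in `⟨M⁺, a, b⟩` by a
`b`-bounded formula. -/
def MulDefinableUpTo (L a b : M) : Prop :=
  ∃ φ : (lin (Fin 2)).Formula (Fin 3), ScalarBounded 1 φ ∧
    letI := scalarStructure ![a, b]
    ∀ x y z : M, φ.Realize ![x, y, z] ↔ (x ≤ L ∧ y ≤ L ∧ z = x * y)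

/-- `⟨M⁺, a, b⟩` is a model of the theory `T`. -/
def ModelsTwo (a b : M) (T : (lin (Fin 2)).Theory) : Prop :=
  letI := scalarStructure ![a, b]
  M ⊨ T

end Statement

end LinArith

/-!
A model `M` of PA is a discretely ordered commutative semiring with definable induction, and it
embeds in an ordered field `K` (`exists_orderedField`). Every formula of `⟨M⁺, a, b⟩` is a formula
of arithmetic with parameters, so `⟨M⁺, a, b⟩` is a model of `LA₂` for all `a` and `b`
(`models_LA`). The two remaining claims are proved as follows.

**Definability of multiplication.** Multiplication on `[0, L]` is definable from the squares of
`1, …, 2L + 1`, by polarization and because `z` is the square of `t` if and only if the next square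
is `z + 2t + 1`. Call `x < a` a record if the remainder of `bx` modulo `a` is smaller than that of
`by` for all `0 < y < x`. This is expressed by a bounded formula, and the records are the
denominators of certain convergents of a continued fraction. If `r / m` and `r' / m'` are
neighbouring fractions, then passing from `r / m` to `(c r - r') / (c m - m')`, for any `c > m'`,
adds precisely the record `m` (`NeighbourFractions.isRecord_step`). As `c` is free, the residues of
the denominators modulo a fixed `S` are free as well, and by induction one obtains records whose
residues are precisely the required squares and possibly `-1` (`exists_isRecord_congruent_sq`).
Congruence modulo `S` is definable once `a ≡ -1` modulo `S`: then `x ≡ y` modulo `S` if and only if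
`bx ≡ by` modulo `a + 1`, provided that `b ≡ (a + 1) / S` modulo `a + 1`. By the Chinese remainder
theorem this can be had together with any prescribed residue of `b` modulo `a`.

**Strictness.** Let one of the scalars, `f`, be definable with parameters from the other one, `e`.
If `f` is not in the field `ℚ(e)` inside `K`, then a transvection `w ↦ w + c(w) d`, with `c` a
`ℚ(e)`-linear functional vanishing on the parameters and on all elements of small order of
magnitude, is an automorphism of `⟨M⁺, e⟩` that fixes the parameters and does not commute with
`f`; this is `mem_closure_of_not_models_axStrict`. If `f` is in `ℚ(e)`, it suffices to find an
automorphism of an initial segment of `⟨M⁺, e⟩` that does not preserve squares, as such a map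
commutes with `f` and preserves bounded formulas (`SegmentAutomorphism.realize_iff`). If `e` is
standard, an automorphism of the ordered additive structure will do. If `e` is non-standard, such an
automorphism is applied to all digits in base `e`, on the segment of numbers below a standard power
of `e` (`segmentAutomorphism_digitLimit`).
-/

namespace LinArith

/-! ### Definability with parameters -/

section Definability

variable {L : FirstOrder.Language.{0, 0}} {M : Type*} [L.Structure M] {n : ℕ}

/-- The relation `P` on `M` is definable with parameters in the `L`-structure `M`. The parameters
are the free variables of the defining formula, which are indexed by `M` itself and interpreted by
the identity. -/
def ParamDefinable (L : FirstOrder.Language.{0, 0}) {M : Type*} [L.Structure M] {n : ℕ}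
    (P : (Fin n → M) → Prop) : Prop :=
  ∃ φ : L.BoundedFormula M n, ∀ xs, φ.Realize id xs ↔ P xs

/-- The function `g` on `M` is the value of a term with parameters. -/
def ParamTerm (L : FirstOrder.Language.{0, 0}) {M : Type*} [L.Structure M] {n : ℕ}
    (g : (Fin n → M) → M) : Prop :=
  ∃ t : L.Term (M ⊕ Fin n), ∀ xs, t.realize (Sum.elim id xs) = g xs

namespace ParamTerm

theorem param (m : M) : ParamTerm L fun _ : Fin n → M => m := ⟨.var (.inl m), fun _ => rfl⟩

theorem var (i : Fin n) : ParamTerm L fun xs : Fin n → M => xs i := ⟨.var (.inr i), fun _ => rfl⟩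

theorem func {l : ℕ} (f : L.Functions l) {g : Fin l → (Fin n → M) → M}
    (hg : ∀ i, ParamTerm L (g i)) :
    ParamTerm L fun xs => Structure.funMap f fun i => g i xs := by
  choose t ht using hg
  exact ⟨.func f t, fun xs => by simp [ht]⟩

/-- A term may be viewed as a term with an additional last variable. -/
theorem init {g : (Fin n → M) → M} (hg : ParamTerm L g) :
    ParamTerm L fun ys : Fin (n + 1) → M => g fun i => ys i.castSucc := by
  obtain ⟨t, ht⟩ := hg
  refine ⟨t.relabel (Sum.map id Fin.castSucc), fun ys => ?_⟩
  rw [Term.realize_relabel]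
  refine Eq.trans ?_ (ht _)
  congr 1
  ext a
  rcases a with a | a <;> rfl

end ParamTerm

namespace ParamDefinable

variable {P Q : (Fin n → M) → Prop}

theorem imp (hP : ParamDefinable L P) (hQ : ParamDefinable L Q) :
    ParamDefinable L fun xs => P xs → Q xs := by
  obtain ⟨φ, hφ⟩ := hP
  obtain ⟨ψ, hψ⟩ := hQ
  exact ⟨φ ⟹ ψ, fun xs => by simp [hφ, hψ]⟩

theorem not (hP : ParamDefinable L P) : ParamDefinable L fun xs => ¬ P xs := by
  obtain ⟨φ, hφ⟩ := hP
  exact ⟨∼φ, fun xs => by simp [hφ]⟩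

theorem and (hP : ParamDefinable L P) (hQ : ParamDefinable L Q) :
    ParamDefinable L fun xs => P xs ∧ Q xs := by
  obtain ⟨φ, hφ⟩ := hP
  obtain ⟨ψ, hψ⟩ := hQ
  exact ⟨φ ⊓ ψ, fun xs => by simp [hφ, hψ]⟩

theorem or (hP : ParamDefinable L P) (hQ : ParamDefinable L Q) :
    ParamDefinable L fun xs => P xs ∨ Q xs := by
  obtain ⟨φ, hφ⟩ := hP
  obtain ⟨ψ, hψ⟩ := hQ
  exact ⟨φ ⊔ ψ, fun xs => by simp [hφ, hψ]⟩

/-- Quantification over a fresh variable, which becomes the last one. -/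
theorem all {P : (Fin n → M) → M → Prop}
    (hP : ParamDefinable L fun ys : Fin (n + 1) → M => P (fun i => ys i.castSucc) (ys (Fin.last n))) :
    ParamDefinable L fun xs => ∀ x, P xs x := by
  obtain ⟨φ, hφ⟩ := hP
  exact ⟨∀' φ, fun xs => by simp [hφ]⟩

theorem ex {P : (Fin n → M) → M → Prop}
    (hP : ParamDefinable L fun ys : Fin (n + 1) → M => P (fun i => ys i.castSucc) (ys (Fin.last n))) :
    ParamDefinable L fun xs => ∃ x, P xs x := by
  obtain ⟨φ, hφ⟩ := hP
  exact ⟨∃' φ, fun xs => by simp [hφ]⟩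

theorem eq {f g : (Fin n → M) → M} (hf : ParamTerm L f) (hg : ParamTerm L g) :
    ParamDefinable L fun xs => f xs = g xs := by
  obtain ⟨t, ht⟩ := hf
  obtain ⟨s, hs⟩ := hg
  exact ⟨t =' s, fun xs => by simp [ht, hs]⟩

theorem rel {l : ℕ} (R : L.Relations l) {g : Fin l → (Fin n → M) → M}
    (hg : ∀ i, ParamTerm L (g i)) :
    ParamDefinable L fun xs => Structure.RelMap R fun i => g i xs := by
  choose t ht using hg
  exact ⟨.rel R t, fun xs => by simp [BoundedFormula.Realize, ht]⟩

theorem const (p : Prop) : ParamDefinable L fun _ : Fin n → M => p := by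
  by_cases h : p
  · exact ⟨⊤, fun xs => by simp [h]⟩
  · exact ⟨⊥, fun xs => by simp [h]⟩

end ParamDefinable

theorem realize_substLast {β : Type} (φ : L.Formula (Fin n ⊕ Fin 1))
    (ys : Fin n → L.Term β) (t : L.Term β) (v : β → M) :
    (substLast φ ys t).Realize v ↔
      φ.Realize (Sum.elim (fun i => (ys i).realize v) fun _ => t.realize v) := by
  rw [substLast, Formula.Realize, BoundedFormula.realize_subst, Formula.Realize]
  refine iff_of_eq (congrArg (fun w => BoundedFormula.Realize φ w default) (funext fun a => ?_))
  cases a <;> rfl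

end Definability

/-! ### The axioms of arithmetical theories in a structure -/

section ArithAxioms

variable (L : FirstOrder.Language.{0, 0}) [IsArithmetical L]
  (M : Type*) [Zero M] [One M] [Add M] [LE M] [L.Structure M]

/-- The symbols `0, 1, +, ≤` of `L` are interpreted by the operations of `M`. -/
structure StandardSymbols : Prop where
  zero : ∀ v, Structure.funMap (IsArithmetical.zeroSymb : L.Functions 0) v = (0 : M)
  one : ∀ v, Structure.funMap (IsArithmetical.oneSymb : L.Functions 0) v = (1 : M)
  add : ∀ v : Fin 2 → M, Structure.funMap (IsArithmetical.addSymb : L.Functions 2) v = v 0 + v 1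
  le : ∀ v : Fin 2 → M, Structure.RelMap (leSymb : L.Relations 2) v ↔ v 0 ≤ v 1

/-- The finitely many axioms common to all arithmetical theories. -/
structure BasicAxioms (M : Type*) [Zero M] [One M] [Add M] [LE M] : Prop where
  zero_ne : ∀ z : M, 0 ≠ z + 1
  succ_inj : ∀ x y : M, x + 1 = y + 1 → x = y
  add_zero : ∀ x : M, x + 0 = x
  add_succ : ∀ x y : M, x + (y + 1) = x + y + 1
  le_iff : ∀ x y : M, x ≤ y ↔ ∃ z, x + z = y

/-- Induction for all relations that are definable with parameters in the `L`-structure `M`. -/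
def DefinableInduction : Prop :=
  ∀ P : M → Prop, ParamDefinable L (fun xs : Fin 1 → M => P (xs 0)) →
    P 0 → (∀ x, P x → P (x + 1)) → ∀ x, P x

variable {L M}

namespace StandardSymbols

theorem realize_zero (h : StandardSymbols L M) {α : Type*} (v : α → M) : (tZero : L.Term α).realize v = 0 := by
  simp only [tZero, Constants.term, Term.realize_func]; exact h.zero _

theorem realize_one (h : StandardSymbols L M) {α : Type*} (v : α → M) : (tOne : L.Term α).realize v = 1 := by
  simp only [tOne, Constants.term, Term.realize_func]; exact h.one _

theorem realize_add (h : StandardSymbols L M) {α : Type*} (s t : L.Term α) (v : α → M) :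
    (tAdd s t).realize v = s.realize v + t.realize v := by
  simp [tAdd, Term.realize_functions_apply₂, h.add]

theorem realize_le (h : StandardSymbols L M) {α : Type*} {n : ℕ} (s t : L.Term (α ⊕ Fin n))
    (v : α → M) (xs : Fin n → M) :
    (s.le t).Realize v xs ↔ s.realize (Sum.elim v xs) ≤ t.realize (Sum.elim v xs) := by
  simp [Term.le, BoundedFormula.realize_rel₂, h.le]

theorem realize_axInd (h : StandardSymbols L M) {n : ℕ} (φ : L.Formula (Fin n ⊕ Fin 1)) :
    M ⊨ axInd φ ↔ ∀ p : Fin n → M, φ.Realize (Sum.elim p fun _ => 0) →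
      (∀ x, φ.Realize (Sum.elim p fun _ => x) → φ.Realize (Sum.elim p fun _ => x + 1)) →
      ∀ x, φ.Realize (Sum.elim p fun _ => x) := by
  have e : ∀ Q : (Fin 1 → M) → Prop, (∀ i, Q i) ↔ ∀ x, Q fun _ => x := fun Q =>
    ⟨fun h x => h _, fun h i => by
      have := h (i 0)
      have hi : (fun _ => i 0) = i := funext fun j => by rw [Subsingleton.elim j 0]
      exact hi ▸ this⟩
  rw [axInd, univClosure, Sentence.Realize, Formula.realize_iAlls]
  refine forall_congr' fun p => ?_
  rw [Formula.realize_relabel, Formula.realize_imp, Formula.realize_inf, Formula.realize_iAlls,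
    Formula.realize_iAlls, realize_substLast, and_imp, e, e]
  simp only [Formula.realize_imp, realize_substLast, realize_zero h, realize_add h,
    realize_one h, Term.realize_var, Function.comp_apply, Sum.elim_inr, Sum.elim_inl]
  rfl

end StandardSymbols

theorem definableInduction_iff (h : StandardSymbols L M) :
    DefinableInduction L M ↔ ∀ (n : ℕ) (φ : L.Formula (Fin n ⊕ Fin 1)), M ⊨ axInd φ := by
  classical
  constructor
  · intro hI n φ
    rw [h.realize_axInd]
    intro p
    refine hI (fun x => φ.Realize (Sum.elim p fun _ => x)) ?_
    refine ⟨BoundedFormula.relabel (Sum.map p id) φ, fun xs => ?_⟩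
    rw [BoundedFormula.realize_relabel]
    refine iff_of_eq (congrArg₂ _ (funext fun a => ?_) (Subsingleton.elim _ _))
    rcases a with a | a
    · rfl
    · simp [Subsingleton.elim a 0]
  · rintro hI P ⟨φ, hφ⟩
    let e := φ.freeVarFinset.equivFin
    let ψ : L.Formula (Fin φ.freeVarFinset.card ⊕ Fin 1) := (φ.restrictFreeVar e).toFormula
    have key : ∀ x, ψ.Realize (Sum.elim (fun i => (e.symm i : M)) fun _ => x) ↔ P x := fun x => by
      rw [BoundedFormula.realize_toFormula, BoundedFormula.realize_restrictFreeVar id]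
      · exact hφ _
      · intro a; simp
    have := (h.realize_axInd ψ).1 (hI _ ψ) fun i => e.symm i
    simpa only [key] using this

theorem models_arithTheory_iff (h : StandardSymbols L M) :
    M ⊨ arithTheory L ↔ BasicAxioms M ∧ DefinableInduction L M := by
  have h1 : M ⊨ axA1 L ↔ ∀ z : M, 0 ≠ z + 1 := by
    simp [axA1, Sentence.Realize, Formula.Realize, h.realize_add, h.realize_zero, h.realize_one, bv,
      Fin.snoc]
  have h2 : M ⊨ axA2 L ↔ ∀ x y : M, x + 1 = y + 1 → x = y := by
    simp [axA2, Sentence.Realize, Formula.Realize, h.realize_add, h.realize_one, bv,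
      Fin.snoc]
  have h3 : M ⊨ axA3 L ↔ ∀ x : M, x + 0 = x := by
    simp [axA3, Sentence.Realize, Formula.Realize, h.realize_add, h.realize_zero, bv,
      Fin.snoc]
  have h4 : M ⊨ axA4 L ↔ ∀ x y : M, x + (y + 1) = x + y + 1 := by
    simp [axA4, Sentence.Realize, Formula.Realize, h.realize_add, h.realize_one, bv,
      Fin.snoc]
  have h5 : M ⊨ axD L ↔ ∀ x y : M, x ≤ y ↔ ∃ z, x + z = y := by
    simp [axD, Sentence.Realize, Formula.Realize, h.realize_add, h.realize_le, bv, Fin.snoc]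
  rw [definableInduction_iff h, arithTheory, Theory.model_iff]
  constructor
  · intro H
    refine ⟨⟨h1.1 (H _ ?_), h2.1 (H _ ?_), h3.1 (H _ ?_), h4.1 (H _ ?_), h5.1 (H _ ?_)⟩,
      fun n φ => H _ (Or.inr (Set.mem_iUnion.2 ⟨n, φ, rfl⟩))⟩ <;> simp
  · rintro ⟨H, HI⟩ φ (hφ | hφ)
    · rcases hφ with rfl | rfl | rfl | rfl | rfl
      exacts [h1.2 H.zero_ne, h2.2 H.succ_inj, h3.2 H.add_zero, h4.2 H.add_succ, h5.2 H.le_iff]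
    · obtain ⟨n, φ, rfl⟩ := Set.mem_iUnion.1 hφ
      exact HI n φ

end ArithAxioms

/-! ### Models of Peano arithmetic as ordered semirings -/

section PeanoTerms

variable {M : Type*} [Zero M] [One M] [Add M] [Mul M] [LE M] {n : ℕ}

theorem ParamTerm.add {f g : (Fin n → M) → M} (hf : ParamTerm peano f) (hg : ParamTerm peano g) :
    ParamTerm peano fun xs => f xs + g xs :=
  ParamTerm.func (L := peano) (g := ![f, g]) PeanoFunc.add
    (Fin.forall_fin_two.2 ⟨hf, hg⟩)

theorem ParamTerm.mul {f g : (Fin n → M) → M} (hf : ParamTerm peano f) (hg : ParamTerm peano g) :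
    ParamTerm peano fun xs => f xs * g xs :=
  ParamTerm.func (L := peano) (g := ![f, g]) PeanoFunc.mul
    (Fin.forall_fin_two.2 ⟨hf, hg⟩)

theorem ParamDefinable.le {f g : (Fin n → M) → M} (hf : ParamTerm peano f)
    (hg : ParamTerm peano g) : ParamDefinable peano fun xs => f xs ≤ g xs :=
  ParamDefinable.rel (L := peano) (g := ![f, g]) LeRel.le
    (Fin.forall_fin_two.2 ⟨hf, hg⟩)

theorem standardSymbols_peano : StandardSymbols peano M where
  zero _ := rfl
  one _ := rfl
  add _ := rfl
  le _ := Iff.rfl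

/-- The axioms of Peano arithmetic, with induction for relations definable with parameters. -/
structure PeanoAxioms (M : Type*) [Zero M] [One M] [Add M] [Mul M] [LE M] : Prop
    extends BasicAxioms M where
  mul_zero : ∀ x : M, x * 0 = 0
  mul_succ : ∀ x y : M, x * (y + 1) = x * y + x
  ind : DefinableInduction peano M

theorem realize_tMul {α : Type*} (s t : peano.Term α) (v : α → M) :
    (tMul s t).realize v = s.realize v * t.realize v := by
  exact Term.realize_functions_apply₂ (L := peano)

theorem PeanoAxioms.of_models (h : M ⊨ PA) : PeanoAxioms M := by
  have hs := standardSymbols_peano (M := M)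
  rw [PA, Theory.model_union_iff] at h
  obtain ⟨hb, hi⟩ := (models_arithTheory_iff hs).1 h.1
  refine ⟨hb, ?_, ?_, hi⟩
  · have : M ⊨ axMulZero := h.2.realize_of_mem _ (Or.inl rfl)
    simpa [axMulZero, Sentence.Realize, Formula.Realize, hs.realize_zero, realize_tMul, bv,
      Fin.snoc] using this
  · have : M ⊨ axMulSucc := h.2.realize_of_mem _ (Or.inr rfl)
    simpa [axMulSucc, Sentence.Realize, Formula.Realize, hs.realize_add, hs.realize_one,
      realize_tMul, bv, Fin.snoc] using this

end PeanoTerms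

namespace PeanoAxioms

variable {M : Type*} [Zero M] [One M] [Add M] [Mul M] [LE M]

theorem induct_eq (h : PeanoAxioms M) (f g : M → M)
    (hf : ParamTerm peano fun xs : Fin 1 → M => f (xs 0))
    (hg : ParamTerm peano fun xs : Fin 1 → M => g (xs 0)) (h0 : f 0 = g 0)
    (hs : ∀ x, f x = g x → f (x + 1) = g (x + 1)) (x : M) : f x = g x :=
  h.ind (fun x => f x = g x) (.eq hf hg) h0 hs x

theorem zero_add (h : PeanoAxioms M) (x : M) : 0 + x = x :=
  h.induct_eq (fun t => 0 + t) (fun t => t)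
    (.add (.param _) (.var _)) (.var _) (h.add_zero 0)
    (fun x hx => by rw [h.add_succ, hx]) x

theorem succ_add (h : PeanoAxioms M) (x y : M) : x + 1 + y = x + y + 1 :=
  h.induct_eq (fun t => x + 1 + t) (fun t => x + t + 1)
    (.add (.param _) (.var _))
    (.add (.add (.param _) (.var _)) (.param _)) (by rw [h.add_zero, h.add_zero])
    (fun y hy => by rw [h.add_succ, hy, h.add_succ]) y

theorem add_comm (h : PeanoAxioms M) (x y : M) : x + y = y + x :=
  h.induct_eq (fun t => x + t) (fun t => t + x)
    (.add (.param _) (.var _)) (.add (.var _) (.param _))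
    (by rw [h.add_zero, h.zero_add]) (fun y hy => by rw [h.add_succ, hy, h.succ_add]) y

theorem add_assoc (h : PeanoAxioms M) (x y z : M) : x + y + z = x + (y + z) :=
  h.induct_eq (fun t => x + y + t) (fun t => x + (y + t))
    (.add (.param _) (.var _))
    (.add (.param _) (.add (.param _) (.var _))) (by rw [h.add_zero, h.add_zero])
    (fun z hz => by rw [h.add_succ, hz, h.add_succ, h.add_succ]) z

theorem zero_mul (h : PeanoAxioms M) (x : M) : 0 * x = 0 :=
  h.induct_eq (fun t => 0 * t) (fun t => 0)
    (.mul (.param _) (.var _)) (.param _) (h.mul_zero 0)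
    (fun x hx => by rw [h.mul_succ, hx, h.add_zero]) x

theorem succ_mul (h : PeanoAxioms M) (x y : M) : (x + 1) * y = x * y + y :=
  h.induct_eq (fun t => (x + 1) * t) (fun t => x * t + t)
    (.mul (.param _) (.var _))
    (.add (.mul (.param _) (.var _)) (.var _)) (by rw [h.mul_zero, h.mul_zero, h.add_zero])
    (fun y hy => by
      rw [h.mul_succ, hy, h.mul_succ, h.add_assoc, h.add_assoc, h.add_succ, h.add_succ,
        h.add_comm y x, h.add_succ, h.add_succ]) y

theorem mul_comm (h : PeanoAxioms M) (x y : M) : x * y = y * x :=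
  h.induct_eq (fun t => x * t) (fun t => t * x)
    (.mul (.param _) (.var _)) (.mul (.var _) (.param _))
    (by rw [h.mul_zero, h.zero_mul]) (fun y hy => by rw [h.mul_succ, hy, h.succ_mul]) y

theorem mul_add (h : PeanoAxioms M) (x y z : M) : x * (y + z) = x * y + x * z :=
  h.induct_eq (fun t => x * (y + t)) (fun t => x * y + x * t)
    (.mul (.param _) (.add (.param _) (.var _)))
    (.add (.param _) (.mul (.param _) (.var _))) (by rw [h.mul_zero, h.add_zero, h.add_zero])
    (fun z hz => by rw [h.add_succ, h.mul_succ, hz, h.mul_succ, h.add_assoc]) z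

theorem mul_assoc (h : PeanoAxioms M) (x y z : M) : x * y * z = x * (y * z) :=
  h.induct_eq (fun t => x * y * t) (fun t => x * (y * t))
    (.mul (.param _) (.var _))
    (.mul (.param _) (.mul (.param _) (.var _))) (by simp only [h.mul_zero])
    (fun z hz => by rw [h.mul_succ, hz, h.mul_succ, h.mul_add]) z

theorem mul_one (h : PeanoAxioms M) (x : M) : x * 1 = x := by
  have := h.mul_succ x 0
  rwa [h.zero_add, h.mul_zero, h.zero_add] at this

theorem zero_or_succ (h : PeanoAxioms M) (x : M) : x = 0 ∨ ∃ y, x = y + 1 :=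
  h.ind (fun x => x = 0 ∨ ∃ y, x = y + 1)
    (.or (.eq (.var _) (.param _)) (.ex (.eq (.var _) (.add (.var _) (.param _)))))
    (Or.inl rfl) (fun x _ => Or.inr ⟨x, rfl⟩) x

theorem add_right_cancel (h : PeanoAxioms M) (x y z : M) : x + z = y + z → x = y :=
  h.ind (fun z => x + z = y + z → x = y)
    (.imp (.eq (.add (.param _) (.var _)) (.add (.param _) (.var _))) (.const _))
    (fun hz => by rwa [h.add_zero, h.add_zero] at hz)
    (fun z hz hz' => hz (h.succ_inj _ _ (by rwa [h.add_succ, h.add_succ] at hz'))) z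

theorem eq_zero_of_add_eq_zero (h : PeanoAxioms M) {x y : M} (hxy : x + y = 0) : y = 0 := by
  rcases h.zero_or_succ y with rfl | ⟨z, rfl⟩
  · rfl
  · rw [h.add_succ] at hxy
    exact absurd hxy.symm (h.zero_ne _)

theorem le_total (h : PeanoAxioms M) (x y : M) : x ≤ y ∨ y ≤ x := by
  refine h.ind (fun x => x ≤ y ∨ y ≤ x)
    (.or (.le (.var _) (.param _)) (.le (.param _) (.var _)))
    (Or.inl ((h.le_iff _ _).2 ⟨y, h.zero_add y⟩)) (fun x hx => ?_) x
  simp only [h.le_iff] at hx ⊢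
  rcases hx with ⟨z, rfl⟩ | ⟨z, rfl⟩
  · rcases h.zero_or_succ z with rfl | ⟨w, rfl⟩
    · exact Or.inr ⟨1, by rw [h.add_zero]⟩
    · exact Or.inl ⟨w, by rw [h.succ_add, h.add_succ]⟩
  · exact Or.inr ⟨z + 1, by rw [h.add_succ]⟩

/-- A model of Peano arithmetic is a commutative semiring. -/
@[reducible] def commSemiring (h : PeanoAxioms M) : CommSemiring M where
  add_assoc := h.add_assoc
  zero_add := h.zero_add
  add_zero := h.add_zero
  add_comm := h.add_comm
  left_distrib := h.mul_add
  right_distrib x y z := by rw [h.mul_comm, h.mul_add, h.mul_comm z, h.mul_comm z]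
  zero_mul := h.zero_mul
  mul_zero := h.mul_zero
  mul_assoc := h.mul_assoc
  one_mul x := by rw [h.mul_comm, h.mul_one]
  mul_one := h.mul_one
  mul_comm := h.mul_comm
  nsmul := nsmulRec

/-- A model of Peano arithmetic is linearly ordered. -/
@[reducible] noncomputable def linearOrder (h : PeanoAxioms M) : LinearOrder M where
  le_refl x := (h.le_iff _ _).2 ⟨0, h.add_zero x⟩
  le_trans x y z := by
    simp only [h.le_iff]
    rintro ⟨u, rfl⟩ ⟨v, rfl⟩
    exact ⟨u + v, (h.add_assoc _ _ _).symm⟩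
  le_antisymm x y := by
    simp only [h.le_iff]
    rintro ⟨u, rfl⟩ ⟨v, hv⟩
    have huv : v + u = 0 :=
      h.add_right_cancel _ _ x (by rw [h.zero_add, h.add_comm, h.add_comm v, ← h.add_assoc, hv])
    have hu : u = 0 := h.eq_zero_of_add_eq_zero huv
    exact hu ▸ (h.add_zero x).symm
  le_total := h.le_total
  toDecidableLE := Classical.decRel _

theorem isStrictOrderedRing (h : PeanoAxioms M) :
    letI := h.commSemiring; letI := h.linearOrder; IsStrictOrderedRing M := by
  let := h.commSemiring; let := h.linearOrder
  have hlt : ∀ x y : M, x < y ↔ ∃ z, x + (z + 1) = y := fun x y => by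
    rw [lt_iff_le_and_ne, h.le_iff]
    constructor
    · rintro ⟨⟨z, rfl⟩, hne⟩
      rcases h.zero_or_succ z with rfl | ⟨w, rfl⟩
      · exact absurd (h.add_zero x).symm hne
      · exact ⟨w, rfl⟩
    · rintro ⟨z, rfl⟩
      refine ⟨⟨_, rfl⟩, fun he => h.zero_ne z (h.add_right_cancel _ _ x ?_)⟩
      rw [h.zero_add, h.add_comm, ← he]
  have hmul : ∀ a : M, 0 < a → ∀ b c : M, b < c → a * b < a * c := by
    intro a ha b c hbc
    rw [hlt] at *
    obtain ⟨u, rfl⟩ := ha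
    obtain ⟨v, rfl⟩ := hbc
    exact ⟨u * v + u + v, by ring⟩
  exact
    { add_le_add_left := fun a b hab c => by
        rw [h.le_iff] at *
        obtain ⟨z, rfl⟩ := hab
        exact ⟨z, by ring⟩
      le_of_add_le_add_left := fun a b c hab => by
        rw [h.le_iff] at *
        obtain ⟨z, hz⟩ := hab
        exact ⟨z, h.add_right_cancel _ _ a (by rw [h.add_comm c a, ← hz]; ring)⟩
      zero_le_one := (h.le_iff _ _).2 ⟨1, h.zero_add 1⟩
      exists_pair_ne := ⟨0, 1, fun h01 => h.zero_ne 0 (by rw [h.zero_add]; exact h01)⟩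
      mul_lt_mul_of_pos_left := fun a ha b c hbc => hmul a ha b c hbc
      mul_lt_mul_of_pos_right := fun a ha b c hbc => by
        have := hmul a ha b c hbc
        rwa [h.mul_comm a, h.mul_comm a] at this }

theorem canonicallyOrderedAdd (h : PeanoAxioms M) :
    letI := h.commSemiring; letI := h.linearOrder; CanonicallyOrderedAdd M := by
  let := h.commSemiring; let := h.linearOrder
  have hle : ∀ a b : M, a ≤ a + b := fun a b => (h.le_iff _ _).2 ⟨b, rfl⟩
  exact
    { exists_add_of_le := fun {a b} hab => by
        obtain ⟨z, hz⟩ := (h.le_iff a b).1 hab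
        exact ⟨z, hz.symm⟩
      le_add_self := fun a b => by rw [h.add_comm]; exact hle a b
      le_self_add := hle }

end PeanoAxioms

/-! ### The ordered field of fractions of a canonically ordered semiring -/

section Differences

variable (M : Type*) [CommSemiring M] [IsCancelAdd M]

/-- Pairs `(a, b)` and `(c, d)` are related if `a - b = c - d`. -/
@[reducible] def diffSetoid : Setoid (M × M) where
  r p q := p.1 + q.2 = q.1 + p.2
  iseqv :=
    { refl := fun _ => rfl
      symm := fun h => h.symm
      trans := fun {p q r} h₁ h₂ => by
        apply add_right_cancel (b := q.2)
        calc p.1 + r.2 + q.2 = (p.1 + q.2) + r.2 := by ring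
          _ = (q.1 + r.2) + p.2 := by rw [h₁]; ring
          _ = r.1 + p.2 + q.2 := by rw [h₂]; ring }

/-- The ring of formal differences of elements of a cancellative commutative semiring. -/
def DiffRing : Type _ := Quotient (diffSetoid M)

variable {M}

namespace DiffRing

/-- The class of the pair `(a, b)`, standing for `a - b`. -/
def mk (a b : M) : DiffRing M := Quotient.mk (diffSetoid M) (a, b)

theorem mk_eq_mk {a b c d : M} : mk a b = mk c d ↔ a + d = c + b := Quotient.eq (r := diffSetoid M)

theorem ind {P : DiffRing M → Prop} (h : ∀ a b, P (mk a b)) (x : DiffRing M) : P x :=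
  Quotient.inductionOn x fun p => h p.1 p.2

instance : Add (DiffRing M) :=
  ⟨Quotient.map₂ (fun p q => (p.1 + q.1, p.2 + q.2)) fun p p' hp q q' hq => by
    change p.1 + q.1 + (p'.2 + q'.2) = p'.1 + q'.1 + (p.2 + q.2)
    calc _ = (p.1 + p'.2) + (q.1 + q'.2) := by ring
      _ = _ := by rw [show p.1 + p'.2 = p'.1 + p.2 from hp, show q.1 + q'.2 = q'.1 + q.2 from hq]
                  ring⟩

instance : Mul (DiffRing M) :=
  ⟨Quotient.map₂ (fun p q => (p.1 * q.1 + p.2 * q.2, p.1 * q.2 + p.2 * q.1))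
    fun p p' hp q q' hq => by
      change p.1 * q.1 + p.2 * q.2 + (p'.1 * q'.2 + p'.2 * q'.1) =
        p'.1 * q'.1 + p'.2 * q'.2 + (p.1 * q.2 + p.2 * q.1)
      have hp : p.1 + p'.2 = p'.1 + p.2 := hp
      have hq : q.1 + q'.2 = q'.1 + q.2 := hq
      apply add_right_cancel (b := p'.1 * q.2 + p'.2 * q.1)
      calc _ = (p.1 + p'.2) * q.1 + p.2 * q.2 + p'.1 * (q.2 + q'.2) + p'.2 * q'.1 := by ring
        _ = p'.1 * (q.1 + q'.2) + p.2 * (q.1 + q.2) + p'.1 * q.2 + p'.2 * q'.1 := by rw [hp]; ring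
        _ = p'.1 * q'.1 + p.2 * q.1 + (p'.1 + p.2) * q.2 + p'.1 * q.2 + p'.2 * q'.1 := by
          rw [hq]; ring
        _ = p'.1 * q'.1 + p.2 * q.1 + p.1 * q.2 + p'.1 * q.2 + p'.2 * (q'.1 + q.2) := by
          rw [← hp]; ring
        _ = _ := by rw [← hq]; ring⟩

instance : Neg (DiffRing M) :=
  ⟨Quotient.map (fun p => (p.2, p.1)) fun p q h => by
    change p.2 + q.1 = q.2 + p.1
    rw [add_comm, ← show p.1 + q.2 = q.1 + p.2 from h, add_comm]⟩

instance : Zero (DiffRing M) := ⟨mk 0 0⟩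

instance : One (DiffRing M) := ⟨mk 1 0⟩

theorem mk_add (a b c d : M) : mk a b + mk c d = mk (a + c) (b + d) := rfl

theorem mk_mul (a b c d : M) : mk a b * mk c d = mk (a * c + b * d) (a * d + b * c) := rfl

theorem neg_mk (a b : M) : -mk a b = mk b a := rfl

theorem zero_def : (0 : DiffRing M) = mk 0 0 := rfl

theorem one_def : (1 : DiffRing M) = mk 1 0 := rfl

instance : CommRing (DiffRing M) where
  add_assoc := ind fun a b => ind fun c d => ind fun e f => by
    simp only [mk_add, add_assoc]
  zero_add := ind fun a b => by simp only [zero_def, mk_add, zero_add]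
  add_zero := ind fun a b => by simp only [zero_def, mk_add, add_zero]
  add_comm := ind fun a b => ind fun c d => by
    rw [mk_add, mk_add, add_comm a, add_comm b]
  neg_add_cancel := ind fun a b => by
    rw [neg_mk, mk_add, zero_def, mk_eq_mk]; ring
  left_distrib := ind fun a b => ind fun c d => ind fun e f => by
    simp only [mk_add, mk_mul, mk_eq_mk]; ring
  right_distrib := ind fun a b => ind fun c d => ind fun e f => by
    simp only [mk_add, mk_mul, mk_eq_mk]; ring
  zero_mul := ind fun a b => by simp only [zero_def, mk_mul, mk_eq_mk]; ring
  mul_zero := ind fun a b => by simp only [zero_def, mk_mul, mk_eq_mk]; ring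
  mul_assoc := ind fun a b => ind fun c d => ind fun e f => by
    simp only [mk_mul, mk_eq_mk]; ring
  one_mul := ind fun a b => by simp only [one_def, mk_mul, mk_eq_mk]; ring
  mul_one := ind fun a b => by simp only [one_def, mk_mul, mk_eq_mk]; ring
  mul_comm := ind fun a b => ind fun c d => by simp only [mk_mul, mk_eq_mk]; ring
  nsmul := nsmulRec
  zsmul := zsmulRec

/-- The embedding of a cancellative semiring into its ring of differences. -/
def of : M →+* DiffRing M where
  toFun a := mk a 0
  map_zero' := rfl
  map_one' := rfl
  map_add' a b := by simp only [mk_add, add_zero]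
  map_mul' a b := by simp only [mk_mul, mk_eq_mk]; ring

theorem of_injective : Function.Injective (of : M → DiffRing M) := fun a b h => by
  simpa using mk_eq_mk.1 h

theorem exists_eq_sub (x : DiffRing M) : ∃ a b : M, x = of a - of b :=
  ind (P := fun x => ∃ a b : M, x = of a - of b) (fun a b => ⟨a, b, by
    rw [sub_eq_add_neg]
    change _ = mk a 0 + -mk b 0
    rw [neg_mk, mk_add, add_zero, zero_add]⟩) x

theorem of_eq_zero {a : M} : (of a : DiffRing M) = 0 ↔ a = 0 :=
  map_eq_zero_iff _ of_injective

end DiffRing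

/-- The canonical map of a cancellative semiring into the field of fractions of its ring of differences. -/
noncomputable def toFrac : M →+* FractionRing (DiffRing M) :=
  (algebraMap (DiffRing M) (FractionRing (DiffRing M))).comp DiffRing.of

theorem toFrac_injective : Function.Injective (toFrac (M := M)) :=
  (IsFractionRing.injective (DiffRing M) (FractionRing (DiffRing M))).comp DiffRing.of_injective

theorem toFrac_eq_zero {a : M} : toFrac a = 0 ↔ a = 0 := map_eq_zero_iff _ toFrac_injective

end Differences

section OrderedField

variable {M : Type*} [CommSemiring M] [LinearOrder M] [IsStrictOrderedRing M]
  [CanonicallyOrderedAdd M]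

namespace DiffRing

theorem exists_eq_or_neg (x : DiffRing M) : ∃ a : M, x = of a ∨ x = -of a := by
  obtain ⟨a, b, rfl⟩ := x.exists_eq_sub
  rcases le_total a b with h | h
  · obtain ⟨c, rfl⟩ := exists_add_of_le h
    exact ⟨c, Or.inr (by rw [map_add]; ring)⟩
  · obtain ⟨c, rfl⟩ := exists_add_of_le h
    exact ⟨c, Or.inl (by rw [map_add]; ring)⟩

instance : IsDomain (DiffRing M) :=
  have : Nontrivial (DiffRing M) := of_injective.nontrivial
  have : NoZeroDivisors (DiffRing M) := ⟨fun {x y} h => by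
    obtain ⟨a, ha⟩ := x.exists_eq_or_neg
    obtain ⟨b, hb⟩ := y.exists_eq_or_neg
    have hab : (of (a * b) : DiffRing M) = 0 := by
      rw [map_mul]
      rcases ha with rfl | rfl <;> rcases hb with rfl | rfl <;> simpa using h
    rw [of_eq_zero, mul_eq_zero] at hab
    rcases hab with rfl | rfl
    · left; simpa using ha
    · right; simpa using hb⟩
  NoZeroDivisors.to_isDomain _

end DiffRing

/-- The quotients of elements of the semiring form the cone of non-negative elements of the
fraction field. -/
noncomputable def fracCone (M : Type*) [CommSemiring M] [LinearOrder M] [IsStrictOrderedRing M]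
    [CanonicallyOrderedAdd M] : RingCone (FractionRing (DiffRing M)) where
  carrier := {x | ∃ a b : M, b ≠ 0 ∧ x = toFrac a / toFrac b}
  zero_mem' := ⟨0, 1, one_ne_zero, by simp⟩
  one_mem' := ⟨1, 1, one_ne_zero, by simp⟩
  add_mem' := by
    rintro _ _ ⟨a, b, hb, rfl⟩ ⟨c, d, hd, rfl⟩
    exact ⟨a * d + b * c, b * d, mul_ne_zero hb hd, by
      rw [div_add_div _ _ (toFrac_eq_zero.not.2 hb) (toFrac_eq_zero.not.2 hd)]; simp⟩
  mul_mem' := by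
    rintro _ _ ⟨a, b, hb, rfl⟩ ⟨c, d, hd, rfl⟩
    exact ⟨a * c, b * d, mul_ne_zero hb hd, by rw [div_mul_div_comm]; simp⟩
  eq_zero_of_mem_of_neg_mem' := by
    rintro _ ⟨a, b, hb, rfl⟩ ⟨c, d, hd, h⟩
    have hb' := toFrac_eq_zero.not.2 hb
    have hd' := toFrac_eq_zero.not.2 hd
    have : toFrac (a * d + c * b) = 0 := by
      rw [neg_eq_iff_eq_neg, eq_neg_iff_add_eq_zero, div_add_div _ _ hb' hd',
        div_eq_zero_iff] at h
      simpa [hb', hd', mul_comm] using h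
    rw [toFrac_eq_zero, add_eq_zero, mul_eq_zero] at this
    simp [this.1.resolve_right hd]

/-- A canonically ordered cancellative semiring embeds into an ordered field. -/
theorem exists_orderedField.{u} (M : Type u) [CommSemiring M] [LinearOrder M] [IsStrictOrderedRing M]
    [CanonicallyOrderedAdd M] : ∃ (K : Type u) (_ : Field K) (_ : LinearOrder K)
    (_ : IsStrictOrderedRing K) (ι : M →+* K), StrictMono ι := by
  classical
  have hdiv : ∀ x : FractionRing (DiffRing M), ∃ a b : M, b ≠ 0 ∧
      (x = toFrac a / toFrac b ∨ x = -(toFrac a / toFrac b)) := by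
    intro x
    obtain ⟨u, v, hv, rfl⟩ := IsFractionRing.div_surjective (A := DiffRing M) x
    have hv0 : v ≠ 0 := nonZeroDivisors.ne_zero hv
    obtain ⟨a, ha⟩ := u.exists_eq_or_neg
    obtain ⟨b, hb⟩ := v.exists_eq_or_neg
    refine ⟨a, b, ?_, ?_⟩
    · rintro rfl; simp at hb; exact hv0 hb
    · rcases ha with rfl | rfl <;> rcases hb with rfl | rfl <;> simp [toFrac, div_neg, neg_div]
  have : HasMemOrNegMem (fracCone M) := ⟨fun x => by
    obtain ⟨a, b, hb, h | h⟩ := hdiv x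
    · exact Or.inl ⟨a, b, hb, h⟩
    · exact Or.inr ⟨a, b, hb, by rw [h, neg_neg]⟩⟩
  let hK : LinearOrder (FractionRing (DiffRing M)) := LinearOrder.mkOfAddGroupCone (fracCone M)
  have hO : IsOrderedRing (FractionRing (DiffRing M)) := IsOrderedRing.mkOfCone (fracCone M)
  refine ⟨FractionRing (DiffRing M), inferInstance, hK,
    IsOrderedRing.toIsStrictOrderedRing _, toFrac, ?_⟩
  refine Monotone.strictMono_of_injective (fun a b hab => ?_) toFrac_injective
  obtain ⟨c, rfl⟩ := exists_add_of_le hab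
  exact ⟨c, 1, one_ne_zero, by simp⟩

end OrderedField

/-! ### Consequences of induction -/

theorem unaryCast_eq {M : Type*} [CommSemiring M] (n : ℕ) : (Nat.unaryCast n : M) = n := by
  induction n with
  | zero => simp [Nat.unaryCast]
  | succ n ih => simp [Nat.unaryCast, ih]

theorem isNonstandard_iff {M : Type*} [CommSemiring M] {x : M} : IsNonstandard x ↔ ∀ n : ℕ, x ≠ n := by
  simp only [IsNonstandard, unaryCast_eq]

theorem ParamDefinable.comp_var {L : FirstOrder.Language.{0, 0}} {M : Type*} [L.Structure M]
    {P : M → Prop} (hP : ParamDefinable L fun xs : Fin 1 → M => P (xs 0)) {n : ℕ} (i : Fin n) :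
    ParamDefinable L fun ys : Fin n → M => P (ys i) := by
  obtain ⟨φ, hφ⟩ := hP
  refine ⟨BoundedFormula.relabel (n := n) (Sum.map id fun _ => i) φ.toFormula, fun ys => ?_⟩
  rw [BoundedFormula.realize_relabel]
  refine Iff.trans (iff_of_eq ?_)
    ((BoundedFormula.realize_toFormula φ (Sum.elim id fun _ => ys i)).trans (hφ fun _ => ys i))
  refine congrArg₂ _ (funext fun a => ?_) (Subsingleton.elim _ _)
  cases a <;> rfl

section Induction

set_option linter.unusedSectionVars false

variable {M : Type*} [CommSemiring M] [LinearOrder M]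

theorem ParamDefinable.lt {n : ℕ} {f g : (Fin n → M) → M} (hf : ParamTerm peano f)
    (hg : ParamTerm peano g) : ParamDefinable peano fun xs => f xs < g xs := by
  simp only [lt_iff_le_not_ge]
  exact (ParamDefinable.le hf hg).and (ParamDefinable.le hg hf).not

theorem ParamDefinable.dvd {n : ℕ} {f g : (Fin n → M) → M} (hf : ParamTerm peano f)
    (hg : ParamTerm peano g) : ParamDefinable peano fun xs => f xs ∣ g xs := by
  simp only [Dvd.dvd]
  exact .ex (.eq hg.init (.mul hf.init (.var _)))

theorem eq_zero_or_succ (hI : DefinableInduction peano M) (x : M) : x = 0 ∨ ∃ y, x = y + 1 :=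
  hI (fun x => x = 0 ∨ ∃ y, x = y + 1)
    (.or (.eq (.var _) (.param _)) (.ex (.eq (.var _) (.add (.var _) (.param _)))))
    (Or.inl rfl) (fun x _ => Or.inr ⟨x, rfl⟩) x

variable [CanonicallyOrderedAdd M]

theorem add_one_le (hI : DefinableInduction peano M) {x y : M} (h : x < y) : x + 1 ≤ y := by
  obtain ⟨c, rfl⟩ := exists_add_of_le h.le
  rcases eq_zero_or_succ hI c with rfl | ⟨c, rfl⟩
  · simp at h
  · rw [← add_assoc, add_right_comm]; exact le_self_add

variable [IsStrictOrderedRing M]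

theorem lt_add_one_iff' (hI : DefinableInduction peano M) {x y : M} : x < y + 1 ↔ x ≤ y :=
  ⟨fun h => by
    by_contra! h'
    exact absurd (add_one_le hI h') (not_le.2 h), fun h => h.trans_lt (lt_add_one y)⟩

theorem one_le_of_ne_zero (hI : DefinableInduction peano M) {x : M} (h : x ≠ 0) : 1 ≤ x := by
  simpa using add_one_le hI (pos_of_ne_zero h)

theorem IsNonstandard.natCast_lt (hI : DefinableInduction peano M) {x : M} (h : IsNonstandard x)
    (n : ℕ) : (n : M) < x := by
  rw [isNonstandard_iff] at h
  induction n with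
  | zero => simpa using pos_of_ne_zero (by simpa using h 0 : x ≠ 0)
  | succ n ih => exact lt_of_le_of_ne (by simpa using add_one_le hI ih) (h _).symm

theorem exists_natCast_eq_of_le (hI : DefinableInduction peano M) {x : M} {n : ℕ} (h : x ≤ n) :
    ∃ m : ℕ, x = m := by
  by_contra! hx
  exact absurd h (not_le.2 ((isNonstandard_iff.2 hx).natCast_lt hI n))

/-- A definable property of all standard elements of a non-standard model holds at some
non-standard element. -/
theorem overspill (hI : DefinableInduction peano M) (hM : ∃ x : M, IsNonstandard x)
    {P : M → Prop} (hP : ParamDefinable peano fun xs : Fin 1 → M => P (xs 0))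
    (h : ∀ n : ℕ, P n) : ∃ x, IsNonstandard x ∧ P x := by
  by_contra! H
  obtain ⟨x, hx⟩ := hM
  -- If the claim fails, then the standard elements are cut out by a definable formula.
  have key : ∀ x : M, ∀ y ≤ x, P y := by
    refine hI (fun x => ∀ y, y ≤ x → P y) (.all (.imp (.le (.var _) (.var _)) (hP.comp_var 1))) ?_ ?_
    · intro y hy
      rw [nonpos_iff_eq_zero.1 hy]
      exact_mod_cast h 0
    · intro x hx y hy
      rcases hy.lt_or_eq with hy | rfl
      · exact hx y ((lt_add_one_iff' hI).1 hy)
      · have hs : ¬ IsNonstandard x := fun hn => H x hn (hx x le_rfl)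
        rw [isNonstandard_iff] at hs
        push Not at hs
        obtain ⟨n, rfl⟩ := hs
        exact_mod_cast h (n + 1)
  exact H x hx (key x x le_rfl)

theorem exists_div_mod (hI : DefinableInduction peano M) (x : M) {y : M} (hy : 0 < y) :
    ∃ q r, x = y * q + r ∧ r < y := by
  refine hI (fun x => ∃ q r, x = y * q + r ∧ r < y)
    (.ex (.ex (.and (.eq (.var _) (.add (.mul (.param _) (.var _)) (.var _)))
      (.lt (.var _) (.param _))))) ⟨0, 0, by simp, hy⟩ ?_ x
  rintro x ⟨q, r, rfl, hr⟩
  rcases (add_one_le hI hr).lt_or_eq with h | h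
  · exact ⟨q, r + 1, by ring, h⟩
  · exact ⟨q + 1, 0, by rw [add_assoc, h]; ring, hy⟩

theorem exists_common_multiple (hI : DefinableInduction peano M) (k : M) :
    ∃ F : M, 0 < F ∧ ∀ j, 0 < j → j ≤ k → j ∣ F := by
  refine hI (fun k => ∃ F : M, 0 < F ∧ ∀ j, 0 < j → j ≤ k → j ∣ F)
    (.ex (.and (.lt (.param _) (.var _)) (.all (.imp (.lt (.param _) (.var _))
      (.imp (.le (.var _) (.var _)) (.dvd (.var _) (.var _))))))) ?_ ?_ k
  · exact ⟨1, one_pos, fun j h0 hj => absurd hj (not_le.2 h0)⟩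
  · rintro k ⟨F, hF, h⟩
    refine ⟨F * (k + 1), mul_pos hF (by positivity), fun j h0 hj => ?_⟩
    rcases hj.lt_or_eq with hj | rfl
    · exact (h j h0 ((lt_add_one_iff' hI).1 hj)).mul_right _
    · exact dvd_mul_left _ _

theorem DiffRing.of_dvd_of {x y : M} : (of x : DiffRing M) ∣ of y ↔ x ∣ y := by
  refine ⟨?_, map_dvd _⟩
  rintro ⟨r, hr⟩
  obtain ⟨c, rfl | rfl⟩ := r.exists_eq_or_neg
  · exact ⟨c, of_injective (by simpa using hr)⟩
  · have : (of (y + x * c) : DiffRing M) = 0 := by rw [map_add, hr, map_mul]; ring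
    rw [of_eq_zero, add_eq_zero] at this
    simp [this.1]

/-- The numbers `1 + iF` and `1 + jF` are coprime if `F` is a multiple of `j - i`. -/
theorem isCoprime_one_add_mul {R : Type*} [CommRing R] {F i j : R} (h : j - i ∣ F) :
    IsCoprime (1 + i * F) (1 + j * F) := by
  obtain ⟨g, rfl⟩ := h
  exact ⟨1 - i * g * j, i * g * i, by ring⟩

/-- Every element of a non-standard model has an upper bound for all its standard powers. The bound
is a multiple of the pairwise coprime numbers `1 + iF` with `i` standard. -/
theorem exists_gt_pow (hI : DefinableInduction peano M) (hM : ∃ x : M, IsNonstandard x) (P : M) :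
    ∃ x : M, ∀ n : ℕ, P ^ n < x := by
  obtain ⟨ν, hν⟩ := hM
  obtain ⟨F, hF0, hF⟩ := exists_common_multiple hI (P + ν)
  obtain ⟨x, hx0, hx⟩ := exists_common_multiple hI (1 + ν * F)
  have hPF : P ≤ F := by
    rcases eq_or_ne P 0 with rfl | hP
    · exact hF0.le
    · obtain ⟨c, hc⟩ := hF P (pos_of_ne_zero hP) le_self_add
      rw [hc]
      refine le_mul_of_one_le_right zero_le (one_le_of_ne_zero hI ?_)
      rintro rfl
      simp [hc] at hF0
  refine ⟨x + 1, fun n => (lt_add_one_iff' hI).2 ?_⟩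
  let u : ℕ → M := fun i => 1 + ((i + 1 : ℕ) : M) * F
  have hu : ∀ i, u i ∣ x := fun i => by
    refine hx _ (by positivity) ?_
    change 1 + _ * F ≤ _
    gcongr
    exact (hν.natCast_lt hI _).le
  have hcop : ∀ i j : ℕ, i < j → IsCoprime (DiffRing.of (u i)) (DiffRing.of (u j)) := by
    intro i j hij
    simp only [u, map_add, map_mul, map_one]
    apply isCoprime_one_add_mul
    obtain ⟨m, rfl⟩ := Nat.exists_eq_add_of_lt hij
    have : DiffRing.of (((i + m + 1 + 1 : ℕ) : M)) - DiffRing.of (((i + 1 : ℕ) : M)) =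
        DiffRing.of (((m + 1 : ℕ) : M)) := by
      rw [sub_eq_iff_eq_add, ← map_add]
      congr 1
      push_cast
      ring
    rw [this, DiffRing.of_dvd_of]
    exact hF _ (by positivity) ((hν.natCast_lt hI _).le.trans le_add_self)
  have hprod : (∏ i ∈ Finset.range n, u i) ∣ x := by
    rw [← DiffRing.of_dvd_of, map_prod]
    refine Finset.prod_dvd_of_coprime (fun i _ j _ hij => ?_) fun i _ => map_dvd _ (hu i)
    rcases lt_or_gt_of_ne hij with h | h
    exacts [hcop i j h, (hcop j i h).symm]
  obtain ⟨c, hc⟩ := hprod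
  calc P ^ n = ∏ i ∈ Finset.range n, P := by simp
    _ ≤ ∏ i ∈ Finset.range n, u i := Finset.prod_le_prod' fun i _ => hPF.trans ?_
    _ ≤ x := by
      rw [hc]
      refine le_mul_of_one_le_right zero_le (one_le_of_ne_zero hI ?_)
      rintro rfl
      simp [hc] at hx0
  calc F ≤ F + (1 + i * F) := le_self_add
    _ = u i := by simp only [u]; push_cast; ring

end Induction

/-! ### The scalar expansions of a model are models of linear arithmetic -/

section Scalar

variable {κ : Type} {M : Type*} [CommSemiring M] [LinearOrder M]

theorem standardSymbols_lin (s : κ → M) :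
    letI := scalarStructure s
    StandardSymbols (lin κ) M :=
  letI := scalarStructure s
  { zero := fun _ => rfl
    one := fun _ => rfl
    add := fun _ => rfl
    le := fun _ => Iff.rfl }

theorem realize_tScalar (s : κ → M) {α : Type*} (i : κ) (t : (lin κ).Term α) (v : α → M) :
    letI := scalarStructure s
    (tScalar i t).realize v = s i * t.realize v :=
  letI := scalarStructure s
  Term.realize_functions_apply₁ (L := lin κ)

theorem paramTerm_realize_lin (s : κ → M) {α : Type*} {n : ℕ} (v : α → M)
    (t : (lin κ).Term (α ⊕ Fin n)) :
    letI := scalarStructure s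
    ParamTerm peano fun xs : Fin n → M => t.realize (Sum.elim v xs) := by
  let := scalarStructure s
  induction t with
  | var a =>
    cases a with
    | inl a => exact .param _
    | inr i => exact .var i
  | func f ts ih =>
    cases f with
    | zero => exact .param 0
    | one => exact .param 1
    | add => exact .add (ih 0) (ih 1)
    | scalar i => exact .mul (.param (s i)) (ih 0)

/-- Relations definable in the expansion by scalars are definable in the model of arithmetic. -/
theorem paramDefinable_realize_lin (s : κ → M) {α : Type*} {n : ℕ} (v : α → M)
    (φ : (lin κ).BoundedFormula α n) :
    letI := scalarStructure s
    ParamDefinable peano fun xs : Fin n → M => φ.Realize v xs := by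
  let := scalarStructure s
  induction φ with
  | falsum => exact .const False
  | equal t₁ t₂ => exact .eq (paramTerm_realize_lin s v t₁) (paramTerm_realize_lin s v t₂)
  | rel R ts =>
    cases R with
    | le => exact .le (paramTerm_realize_lin s v (ts 0)) (paramTerm_realize_lin s v (ts 1))
  | imp _ _ h₁ h₂ => exact h₁.imp h₂
  | all _ h =>
    refine .all (P := fun xs x => BoundedFormula.Realize _ v (Fin.snoc xs x)) ?_
    obtain ⟨ψ, hψ⟩ := h
    exact ⟨ψ, fun ys => by rw [hψ]; exact iff_of_eq (congrArg _ (Fin.snoc_init_self ys).symm)⟩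

variable [IsStrictOrderedRing M] [CanonicallyOrderedAdd M]

theorem basicAxioms : BasicAxioms M where
  zero_ne _ h := by simpa using h.symm
  succ_inj _ _ := add_right_cancel
  add_zero := add_zero
  add_succ _ _ := (add_assoc _ _ _).symm
  le_iff x y := by
    rw [le_iff_exists_add]
    simp only [eq_comm]

theorem models_LA (hI : DefinableInduction peano M) (s : κ → M) :
    letI := scalarStructure s
    M ⊨ LA κ := by
  let := scalarStructure s
  have hs := standardSymbols_lin s
  rw [LA, Theory.model_union_iff, Theory.model_union_iff, models_arithTheory_iff hs]
  refine ⟨⟨⟨basicAxioms, ?_⟩, (Theory.model_iff _).2 ?_⟩, (Theory.model_iff _).2 ?_⟩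
  · rintro P ⟨φ, hφ⟩
    refine hI P ?_
    simp only [← hφ]
    exact paramDefinable_realize_lin s id φ
  · rintro _ ⟨i, rfl⟩
    simp [axL1, Sentence.Realize, Formula.Realize, hs.realize_add, hs.realize_one,
      realize_tScalar, bv, Fin.snoc, mul_add]
  · rintro _ ⟨⟨i, j⟩, rfl⟩
    simp [axL2, Sentence.Realize, Formula.Realize, realize_tScalar, bv, Fin.snoc, mul_left_comm]

end Scalar

/-! ### Transvections of a model -/

section Transvection

set_option linter.unusedSectionVars false

variable {M : Type*} [CommSemiring M] [LinearOrder M] [IsStrictOrderedRing M]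
  [CanonicallyOrderedAdd M] {K : Type*} [Field K] [LinearOrder K] [IsStrictOrderedRing K]
  {ι : M →+* K} {e d : M}

theorem map_nonneg_of_strictMono (hι : StrictMono ι) (x : M) : 0 ≤ ι x := by
  simpa using hι.monotone (zero_le (a := x))

theorem exists_eq_sub_of_mem_closure (e : M) {m : K} (hm : m ∈ Subring.closure {ι e}) :
    ∃ x y : M, m = ι x - ι y := by
  induction hm using Subring.closure_induction with
  | mem x hx => exact ⟨e, 0, by simpa using hx⟩
  | zero => exact ⟨0, 0, by simp⟩
  | one => exact ⟨1, 0, by simp⟩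
  | add _ _ _ _ h₁ h₂ =>
    obtain ⟨x, y, rfl⟩ := h₁
    obtain ⟨z, w, rfl⟩ := h₂
    exact ⟨x + z, y + w, by simp only [map_add]; ring⟩
  | neg _ _ h =>
    obtain ⟨x, y, rfl⟩ := h
    exact ⟨y, x, by ring⟩
  | mul _ _ _ _ h₁ h₂ =>
    obtain ⟨x, y, rfl⟩ := h₁
    obtain ⟨z, w, rfl⟩ := h₂
    exact ⟨x * z + y * w, x * w + y * z, by simp only [map_add, map_mul]; ring⟩

theorem exists_eq_of_sub (x y : M) : ∃ z : M, ι x - ι y = ι z ∨ ι x - ι y = -ι z := by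
  rcases le_total x y with h | h <;> obtain ⟨c, rfl⟩ := exists_add_of_le h
  · exact ⟨c, Or.inr (by rw [map_add]; ring)⟩
  · exact ⟨c, Or.inl (by rw [map_add]; ring)⟩

theorem exists_abs_eq_of_mem_closure (hι : StrictMono ι) {m : K}
    (hm : m ∈ Subring.closure {ι e}) :
    ∃ z : M, |m| = ι z ∧ ι z ∈ Subring.closure {ι e} := by
  obtain ⟨x, y, rfl⟩ := exists_eq_sub_of_mem_closure e hm
  obtain ⟨z, h | h⟩ := exists_eq_of_sub (ι := ι) x y
  · exact ⟨z, by rw [h, abs_of_nonneg (map_nonneg_of_strictMono hι z)], h ▸ hm⟩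
  · exact ⟨z, by rw [h, abs_neg, abs_of_nonneg (map_nonneg_of_strictMono hι z)],
      by simpa [h] using neg_mem hm⟩

theorem abs_le_pow_of_mem_closure (hι : StrictMono ι) {m : K}
    (hm : m ∈ Subring.closure {ι e}) : ∃ n : ℕ, |m| ≤ (ι e + 2) ^ n := by
  have he := map_nonneg_of_strictMono hι e
  have h1 : ∀ n : ℕ, 1 ≤ (ι e + 2) ^ n := fun n => one_le_pow₀ (by linarith)
  induction hm using Subring.closure_induction with
  | mem x hx =>
    rw [Set.mem_singleton_iff] at hx
    exact ⟨1, by rw [hx, abs_of_nonneg he]; linarith⟩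
  | zero => exact ⟨0, by simp⟩
  | one => exact ⟨0, by simp⟩
  | add x y _ _ h₁ h₂ =>
    obtain ⟨n, hn⟩ := h₁
    obtain ⟨m, hm⟩ := h₂
    refine ⟨n + m + 1, (abs_add_le x y).trans ?_⟩
    calc |x| + |y| ≤ (ι e + 2) ^ n + (ι e + 2) ^ m := add_le_add hn hm
      _ ≤ (ι e + 2) ^ (n + m) + (ι e + 2) ^ (n + m) :=
        add_le_add (pow_le_pow_right₀ (by linarith) (by omega))
          (pow_le_pow_right₀ (by linarith) (by omega))
      _ ≤ (ι e + 2) ^ (n + m + 1) := by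
        rw [pow_succ]
        nlinarith [h1 (n + m)]
  | neg x _ h => simpa using h
  | mul x y _ _ h₁ h₂ =>
    obtain ⟨n, hn⟩ := h₁
    obtain ⟨m, hm⟩ := h₂
    refine ⟨n + m, ?_⟩
    rw [abs_mul, pow_add]
    exact mul_le_mul hn hm (abs_nonneg _) (by positivity)

theorem abs_le_pow_of_mem_field (hI : DefinableInduction peano M) (hι : StrictMono ι) {s : K}
    (hs : s ∈ Subfield.closure {ι e}) : ∃ n : ℕ, |s| ≤ (ι e + 2) ^ n := by
  obtain ⟨y, hy, z, hz, rfl⟩ := Subfield.mem_closure_iff.1 hs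
  obtain ⟨n, hn⟩ := abs_le_pow_of_mem_closure hι hy
  refine ⟨n, le_trans ?_ hn⟩
  obtain ⟨w, hw, -⟩ := exists_abs_eq_of_mem_closure hι hz
  rw [abs_div, hw]
  rcases eq_or_ne w 0 with rfl | h
  · simp
  · refine div_le_self (abs_nonneg _) ?_
    simpa using hι.monotone (one_le_of_ne_zero hI h)

/-- `d` is a multiple of all non-zero values `m(e)` of integer polynomials. -/
def DivisibleByClosure (ι : M →+* K) (e d : M) : Prop :=
  ∀ z : M, z ≠ 0 → ι z ∈ Subring.closure {ι e} → z ∣ d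

theorem DivisibleByClosure.exists_mul (hι : StrictMono ι) (hd : DivisibleByClosure ι e d) {s : K}
    (hs : s ∈ Subfield.closure {ι e}) : ∃ x : M, s * ι d = ι x ∨ s * ι d = -ι x := by
  obtain ⟨y, hy, z, hz, rfl⟩ := Subfield.mem_closure_iff.1 hs
  obtain ⟨w, hw, hw'⟩ := exists_abs_eq_of_mem_closure hι hz
  rcases eq_or_ne w 0 with rfl | h
  · refine ⟨0, Or.inl ?_⟩
    rw [map_zero, abs_eq_zero] at hw
    simp [hw]
  obtain ⟨c, rfl⟩ := hd w h hw'
  obtain ⟨u, v, rfl⟩ := exists_eq_sub_of_mem_closure e hy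
  have hw0 : ι w ≠ 0 := by simpa using hι.injective.ne h
  obtain ⟨x, hx⟩ := exists_eq_of_sub (ι := ι) (u * c) (v * c)
  refine ⟨x, ?_⟩
  have key : (ι u - ι v) / ι w * ι (w * c) = ι (u * c) - ι (v * c) := by
    simp only [map_mul]; field_simp
  rcases (abs_eq (map_nonneg_of_strictMono hι w)).1 hw with rfl | rfl
  · rw [key]; exact hx
  · rw [div_neg, neg_mul, key, neg_eq_iff_eq_neg, neg_inj]
    exact hx.symm

/-- Let `k = ℚ(e)` and let `d` be a multiple of all non-zero `m(e)`. A `k`-linear functional `c`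
that vanishes at all elements bounded by a `k`-multiple of `d` yields the automorphism
`w ↦ w + c(w) d` of `⟨M⁺, e⟩`. It is bijective since `c(k d) = 0`, and order preserving since
`c(w) ≠ 0` only if `w` exceeds all `k`-multiples of `d`. -/
theorem exists_transvection (hι : StrictMono ι) (hd : DivisibleByClosure ι e d)
    (c : K →ₗ[Subfield.closure {ι e}] Subfield.closure {ι e})
    (hc : ∀ w, (∃ s ∈ Subfield.closure {ι e}, |w| ≤ s * ι d) → c w = 0) :
    ∃ σ : M ≃+o M, ∀ w, ι (σ w) = ι w + c (ι w) * ι d := by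
  -- The functionals `c` and `-c` are treated alike, to obtain the inverse map as well.
  have main : ∀ c : K →ₗ[Subfield.closure {ι e}] Subfield.closure {ι e},
      (∀ w, (∃ s ∈ Subfield.closure {ι e}, |w| ≤ s * ι d) → c w = 0) →
      ∃ τ : M → M, ∀ w, ι (τ w) = ι w + c (ι w) * ι d := by
    intro c hc
    suffices H : ∀ w, ∃ v, ι v = ι w + c (ι w) * ι d from ⟨fun w => (H w).choose,
      fun w => (H w).choose_spec⟩
    intro w
    obtain ⟨x, hx | hx⟩ := hd.exists_mul hι (c (ι w)).2
    · exact ⟨w + x, by rw [hx, map_add]⟩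
    · by_cases hw : w ≤ x
      · have h0 : c (ι w) = 0 := hc _ ⟨-c (ι w), neg_mem (c (ι w)).2, by
          rw [abs_of_nonneg (map_nonneg_of_strictMono hι w), neg_mul, hx, neg_neg]
          exact hι.monotone hw⟩
        exact ⟨w, by simp [h0]⟩
      · obtain ⟨v, rfl⟩ := exists_add_of_le (not_le.1 hw).le
        exact ⟨v, by rw [hx, map_add]; ring⟩
  have hcd : ∀ s : Subfield.closure {ι e}, c (s * ι d) = 0 := fun s => by
    refine hc _ ⟨|(s : K)|, ?_, ?_⟩
    · rcases abs_choice (s : K) with h | h <;> rw [h]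
      exacts [s.2, neg_mem s.2]
    · rw [abs_mul, abs_of_nonneg (map_nonneg_of_strictMono hι d)]
  obtain ⟨τ, hτ⟩ := main c hc
  obtain ⟨τ', hτ'⟩ := main (-c) fun w hw => by simp [hc w hw]
  have hpos : ∀ w, τ w = 0 → w = 0 := by
    intro w hw
    have h := hτ w
    rw [hw, map_zero] at h
    have : c (ι w) = 0 := hc _ ⟨-c (ι w), neg_mem (c (ι w)).2, by
      rw [abs_of_nonneg (map_nonneg_of_strictMono hι w)]; linarith⟩
    refine hι.injective ?_
    rw [map_zero, h, this]; simp
  have hadd : ∀ x y, τ (x + y) = τ x + τ y := fun x y => hι.injective (by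
    simp only [map_add, hτ, Subfield.coe_add]; ring)
  have hmono : ∀ x y, x ≤ y → τ x ≤ τ y := by
    intro x y h
    obtain ⟨z, rfl⟩ := exists_add_of_le h
    rw [hadd]; exact le_self_add
  refine ⟨{ toFun := τ, invFun := τ', left_inv := fun w => ?_, right_inv := fun w => ?_,
            map_add' := hadd, map_le_map_iff' := fun {x y} => ⟨fun h => ?_, hmono x y⟩ }, hτ⟩
  · refine hι.injective ?_
    rw [hτ', hτ]
    simp [hcd]
  · refine hι.injective ?_
    rw [hτ, hτ']
    simp [hcd]
  · by_contra! h'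
    obtain ⟨z, rfl⟩ := exists_add_of_le h'.le
    have h : τ y + τ z ≤ τ y := by rw [← hadd]; exact h
    have hz : τ z = 0 := by simpa using h
    rw [hpos z hz, add_zero] at h'
    exact lt_irrefl _ h'

/-- An automorphism of `⟨M⁺, e⟩` that fixes the elements of a given subspace and moves a given
element outside of it by `d`. -/
theorem exists_automorphism (hι : StrictMono ι) (hd : DivisibleByClosure ι e d)
    (U : Submodule (Subfield.closure {ι e}) K)
    (hU : ∀ w, (∃ s ∈ Subfield.closure {ι e}, |w| ≤ s * ι d) → w ∈ U)
    {x : M} (hx : ι x ∉ U) :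
    ∃ σ : M ≃+o M, (∀ w, σ (e * w) = e * σ w) ∧ (∀ w, ι w ∈ U → σ w = w) ∧ σ x = x + d ∧
      ∀ w, ∃ s ∈ Subfield.closure {ι e}, ι (σ w) = ι w + s * ι d := by
  obtain ⟨f, hfx, hfU⟩ := Submodule.exists_le_ker_of_notMem hx
  let c : K →ₗ[Subfield.closure {ι e}] Subfield.closure {ι e} := (f (ι x))⁻¹ • f
  have hcU : ∀ w ∈ U, c w = 0 := fun w hw => by
    have : f w = 0 := hfU hw
    simp [c, this]
  obtain ⟨σ, hσ⟩ := exists_transvection hι hd c fun w hw => hcU w (hU w hw)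
  refine ⟨σ, fun w => hι.injective ?_, fun w hw => hι.injective ?_, hι.injective ?_, fun w =>
    ⟨_, (c (ι w)).2, hσ w⟩⟩
  · have : c (ι e * ι w) = ⟨ι e, Subfield.subset_closure rfl⟩ * c (ι w) :=
      c.map_smul ⟨ι e, Subfield.subset_closure rfl⟩ (ι w)
    rw [hσ, map_mul, this, map_mul, hσ]
    simp only [Subfield.coe_mul]
    ring
  · rw [hσ, hcU _ hw]; simp
  · have : c (ι x) = 1 := inv_mul_cancel₀ hfx
    rw [hσ, this]; simp

end Transvection

/-! ### Scalars definable from one scalar are rational in it -/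

section Rationality

set_option linter.unusedSectionVars false

variable {M : Type*} [CommSemiring M] [LinearOrder M] [IsStrictOrderedRing M]
  [CanonicallyOrderedAdd M] {K : Type*} [Field K] [LinearOrder K] [IsStrictOrderedRing K]
  {ι : M →+* K}

/-- The subspace of elements that are bounded by a standard power of `B`. -/
def powerBounded (hI : DefinableInduction peano M) (hι : StrictMono ι) (e B : M) (hB : e + 2 ≤ B) :
    Submodule (Subfield.closure {ι e}) K where
  carrier := {w | ∃ n : ℕ, |w| ≤ ι B ^ n}
  zero_mem' := ⟨0, by simp⟩
  add_mem' := by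
    rintro x y ⟨n, hn⟩ ⟨m, hm⟩
    have hB2 : 2 ≤ ι B := by
      have := hι.monotone hB
      rw [map_add, map_ofNat] at this
      linarith [map_nonneg_of_strictMono hι e]
    have h1 : 1 ≤ ι B ^ (n + m) := one_le_pow₀ (by linarith)
    refine ⟨n + m + 1, (abs_add_le x y).trans ?_⟩
    calc |x| + |y| ≤ ι B ^ n + ι B ^ m := add_le_add hn hm
      _ ≤ ι B ^ (n + m) + ι B ^ (n + m) :=
        add_le_add (pow_le_pow_right₀ (by linarith) (by omega))
          (pow_le_pow_right₀ (by linarith) (by omega))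
      _ ≤ ι B ^ (n + m + 1) := by
        rw [pow_succ]
        nlinarith
  smul_mem' := by
    rintro ⟨s, hs⟩ x ⟨n, hn⟩
    obtain ⟨m, hm⟩ := abs_le_pow_of_mem_field hI hι hs
    have he := map_nonneg_of_strictMono hι e
    have hB' : ι e + 2 ≤ ι B := by simpa [map_ofNat] using hι.monotone hB
    refine ⟨m + n, ?_⟩
    change |s * x| ≤ _
    rw [abs_mul, pow_add]
    exact mul_le_mul (hm.trans (pow_le_pow_left₀ (by linarith) hB' m)) hn (abs_nonneg _)
      (pow_nonneg (by linarith) _)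

theorem exists_automorphism_fixing (hI : DefinableInduction peano M)
    (hM : ∃ x : M, IsNonstandard x) (hι : StrictMono ι) (e : M) {n : ℕ} (p : Fin n → M) :
    ∃ (σ : M ≃+o M) (x d : M), d ≠ 0 ∧ (∀ w, σ (e * w) = e * σ w) ∧ σ 1 = 1 ∧
      (∀ i, σ (p i) = p i) ∧ σ x = x + d ∧
      ∀ w, ∃ s ∈ Subfield.closure {ι e}, ι (σ w) = ι w + s * ι d := by
  obtain ⟨y, hy⟩ := exists_gt_pow hI hM (e + 2)
  obtain ⟨d, hd0, hd⟩ := exists_common_multiple hI y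
  have hd' : DivisibleByClosure ι e d := by
    intro z hz hzS
    refine hd z (pos_of_ne_zero hz) ?_
    obtain ⟨n, hn⟩ := abs_le_pow_of_mem_closure hι hzS
    rw [abs_of_nonneg (map_nonneg_of_strictMono hι z)] at hn
    refine (hι.le_iff_le.1 ?_).trans (hy n).le
    simpa [map_ofNat] using hn
  let B := e + 2 + d + ∑ i, p i
  have hB : e + 2 ≤ B := by simp only [B, add_assoc]; gcongr; exact le_self_add
  obtain ⟨x, hx⟩ := exists_gt_pow hI hM B
  let U := powerBounded hI hι e B hB
  have hle : ∀ w, w ≤ B → ι w ∈ U := fun w hw => ⟨1, by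
    rw [abs_of_nonneg (map_nonneg_of_strictMono hι w), pow_one]; exact hι.monotone hw⟩
  have hdU : ι d ∈ U := hle d (by
    simp only [B]; exact le_add_right le_add_self)
  have hU : ∀ w, (∃ s ∈ Subfield.closure {ι e}, |w| ≤ s * ι d) → w ∈ U := by
    rintro w ⟨s, hs, hw⟩
    obtain ⟨n, hn⟩ := U.smul_mem ⟨s, hs⟩ hdU
    exact ⟨n, hw.trans ((le_abs_self _).trans hn)⟩
  have hxU : ι x ∉ U := by
    rintro ⟨n, hn⟩
    rw [abs_of_nonneg (map_nonneg_of_strictMono hι x), ← map_pow] at hn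
    exact absurd (hι.le_iff_le.1 hn) (not_le.2 (hx n))
  obtain ⟨σ, h1, h2, h3, h4⟩ := exists_automorphism hι hd' U hU hxU
  refine ⟨σ, x, d, hd0.ne', h1, h2 _ (hle 1 ?_), fun i => h2 _ (hle _ ?_), h3, h4⟩
  · calc (1 : M) ≤ 1 + (e + 1) := le_self_add
      _ = e + 2 := by ring
      _ ≤ B := hB
  · exact (Finset.single_le_sum (f := p) (fun _ _ => zero_le) (Finset.mem_univ i)).trans
      le_add_self

/-- An automorphism of the ordered additive structure of `M` that commutes with the scalars is an
automorphism of the expansion by scalars. -/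
def scalarEquiv {κ : Type} (s : κ → M) (σ : M ≃+o M) (h1 : σ 1 = 1)
    (hs : ∀ i w, σ (s i * w) = s i * σ w) :
    letI := scalarStructure s
    M ≃[lin κ] M :=
  letI := scalarStructure s
  { toEquiv := σ.toEquiv
    map_fun' := fun {n} f x => by
      cases f with
      | zero => exact map_zero σ
      | one => exact h1
      | add => exact map_add σ _ _
      | scalar i => exact hs i _
    map_rel' := fun {n} r x => by
      cases r with
      | le => exact map_le_map_iff σ }

theorem isExpansionOn_omitScalar {κ : Type} (s : κ → M) (i : κ) :
    letI := scalarStructure s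
    letI := scalarStructure fun j : {j : κ // j ≠ i} => s j
    (omitScalar i).IsExpansionOn M :=
  letI := scalarStructure s
  letI := scalarStructure fun j : {j : κ // j ≠ i} => s j
  { map_onFunction := fun {n} f x => by cases f <;> rfl
    map_onRelation := fun {n} r x => by cases r; rfl }

theorem realize_axStrict {κ : Type} (s : κ → M) (i : κ) {n : ℕ}
    (φ : (lin {j : κ // j ≠ i}).Formula (Fin n ⊕ Fin 2)) :
    (letI := scalarStructure s
     M ⊨ axStrict i φ) ↔
    ∀ p : Fin n → M, ¬ ∀ v : Fin 2 → M, (s i * v 0 = v 1 ↔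
      (letI := scalarStructure fun j : {j : κ // j ≠ i} => s j
       φ.Realize (Sum.elim p v))) := by
  let := scalarStructure s
  let := scalarStructure fun j : {j : κ // j ≠ i} => s j
  have := isExpansionOn_omitScalar s i
  rw [axStrict, univClosure, Sentence.Realize, Formula.realize_iAlls]
  refine forall_congr' fun p => ?_
  rw [Formula.realize_relabel, Formula.realize_not, Formula.realize_iAlls]
  refine not_congr (forall_congr' fun v => ?_)
  rw [Formula.realize_iff, Formula.realize_equal, realize_tScalar, LHom.realize_onFormula]
  rfl

/-- If the scalar `s i` is definable, even with parameters, from the single scalar `e`, then it lies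
in the field `ℚ(e)`: it commutes with an automorphism of `⟨M⁺, e⟩` that moves some `x` to `x + d`
and every `w` by an element of `ℚ(e) d`. -/
theorem mem_closure_of_not_models_axStrict (hI : DefinableInduction peano M)
    (hM : ∃ x : M, IsNonstandard x) (hι : StrictMono ι) {κ : Type} (s : κ → M) (i : κ) {e : M}
    (he : ∀ j ≠ i, s j = e) {n : ℕ} (φ : (lin {j : κ // j ≠ i}).Formula (Fin n ⊕ Fin 2))
    (hφ : letI := scalarStructure s
      ¬ M ⊨ axStrict i φ) :
    ι (s i) ∈ Subfield.closure {ι e} := by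
  rw [realize_axStrict] at hφ
  push Not at hφ
  obtain ⟨p, hp⟩ := hφ
  obtain ⟨σ, x, d, hd, hσe, hσ1, hσp, hσx, hσ⟩ := exists_automorphism_fixing hI hM hι e p
  have hcomm : σ (s i * x) = s i * σ x := by
    let := scalarStructure fun j : {j : κ // j ≠ i} => s j
    let g := scalarEquiv (fun j : {j : κ // j ≠ i} => s j) σ hσ1 fun j w => by
      rw [he j j.2, hσe]
    have h1 := (hp ![x, s i * x]).1 rfl
    rw [← StrongHomClass.realize_formula g] at h1
    have h2 : (g ∘ Sum.elim p ![x, s i * x]) = Sum.elim p ![σ x, σ (s i * x)] := by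
      funext a
      rcases a with a | a
      · exact hσp a
      · fin_cases a <;> rfl
    rw [h2] at h1
    exact ((hp _).2 h1).symm
  obtain ⟨t, ht, h⟩ := hσ (s i * x)
  rw [hcomm, hσx] at h
  have hd0 : ι d ≠ 0 := by simpa using hι.injective.ne hd
  have : ι (s i) = t := by
    apply mul_right_cancel₀ hd0
    simp only [map_mul, map_add] at h
    linear_combination h
  rwa [this]

end Rationality

/-! ### An automorphism of the additive structure that does not respect squares -/

section Squares

set_option linter.unusedSectionVars false

variable {M : Type*} [CommSemiring M] [LinearOrder M] [IsStrictOrderedRing M]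
  [CanonicallyOrderedAdd M]

theorem exists_divisible_pow_le (hI : DefinableInduction peano M)
    (hM : ∃ x : M, IsNonstandard x) {N : M} (hN : IsNonstandard N) :
    ∃ d : M, (∀ n : ℕ, (n : M) < d) ∧ (∀ n : ℕ, n ≠ 0 → (n : M) ∣ d) ∧ d ^ 5 ≤ N := by
  have hstd : ∀ n : ℕ, ∃ d : M, (n : M) ≤ d ∧ (∀ j, 0 < j → j ≤ (n : M) → j ∣ d) ∧
      d * d * d * d * d ≤ N := by
    intro n
    refine ⟨(n.factorial : ℕ), by exact_mod_cast n.self_le_factorial, fun j hj hjn => ?_, ?_⟩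
    · obtain ⟨m, rfl⟩ := exists_natCast_eq_of_le hI hjn
      exact Nat.cast_dvd_cast (Nat.dvd_factorial (by exact_mod_cast hj) (by exact_mod_cast hjn))
    · exact_mod_cast (hN.natCast_lt hI _).le
  obtain ⟨k, hk, d, hkd, hd, hdN⟩ := overspill hI hM
    (P := fun k => ∃ d, k ≤ d ∧ (∀ j, 0 < j → j ≤ k → j ∣ d) ∧ d * d * d * d * d ≤ N)
    (.ex (.and (.le (.var _) (.var _)) (.and (.all (.imp (.lt (.param _) (.var _)) (.imp
      (.le (.var _) (.var _)) (.dvd (.var _) (.var _))))) (.le (.mul (.mul (.mul (.mul (.var _)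
      (.var _)) (.var _)) (.var _)) (.var _)) (.param _))))) hstd
  have hk' : ∀ n : ℕ, (n : M) < k := hk.natCast_lt hI
  refine ⟨d, fun n => (hk' n).trans_le hkd, fun n hn => hd _ ?_ (hk' n).le, ?_⟩
  · exact pos_of_ne_zero (by exact_mod_cast hn)
  · calc d ^ 5 = d * d * d * d * d := by ring
      _ ≤ N := hdN

variable {K : Type*} [Field K] [LinearOrder K] [IsStrictOrderedRing K] {ι : M →+* K}

/-- The subspace of elements that differ from a rational multiple of `e` by at most a rational
multiple of `d`. -/
def nearMultiples (ι : M →+* K) (e d : M) : Submodule (Subfield.closure {ι (0 : M)}) K where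
  carrier := {w | ∃ q ∈ Subfield.closure {ι (0 : M)}, ∃ s ∈ Subfield.closure {ι (0 : M)},
    |w - q * ι e| ≤ s * ι d}
  zero_mem' := ⟨0, zero_mem _, 0, zero_mem _, by simp⟩
  add_mem' := by
    rintro x y ⟨q, hq, s, hs, h⟩ ⟨q', hq', s', hs', h'⟩
    refine ⟨q + q', add_mem hq hq', s + s', add_mem hs hs', ?_⟩
    calc |x + y - (q + q') * ι e| = |(x - q * ι e) + (y - q' * ι e)| := by ring_nf
      _ ≤ |x - q * ι e| + |y - q' * ι e| := abs_add_le _ _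
      _ ≤ (s + s') * ι d := by linarith
  smul_mem' := by
    rintro ⟨r, hr⟩ x ⟨q, hq, s, hs, h⟩
    refine ⟨r * q, mul_mem hr hq, |r| * s, mul_mem ?_ hs, ?_⟩
    · rcases abs_choice r with h | h <;> rw [h]
      exacts [hr, neg_mem hr]
    · change |r * x - r * q * ι e| ≤ _
      rw [mul_assoc r, ← mul_sub, abs_mul, mul_assoc]
      exact mul_le_mul_of_nonneg_left h (abs_nonneg _)

/-- Below every non-standard element there is an `x` whose square is not respected by some
automorphism of the ordered additive structure that fixes a given element `e`, which is `0` or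
non-standard. -/
theorem exists_automorphism_sq_ne (hI : DefinableInduction peano M)
    (hM : ∃ x : M, IsNonstandard x) (hι : StrictMono ι) {L e : M} (hL : IsNonstandard L)
    (he : e = 0 ∨ IsNonstandard e) :
    ∃ t : M ≃+o M, t 1 = 1 ∧ t e = e ∧
      ∃ x, x ≤ L ∧ (e ≠ 0 → x * x < e) ∧ t (x * x) ≠ t x * t x := by
  obtain ⟨N, hN, hNL, hNe⟩ : ∃ N, IsNonstandard N ∧ N ≤ L ∧ (e ≠ 0 → N ≤ e) := by
    rcases he with rfl | he
    · exact ⟨L, hL, le_rfl, by simp⟩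
    · rcases le_total L e with h | h
      · exact ⟨L, hL, le_rfl, fun _ => h⟩
      · exact ⟨e, he, h, fun _ => le_rfl⟩
  obtain ⟨d, hd, hdvd, hdN⟩ := exists_divisible_pow_le hI hM hN
  have hd1 : 1 < d := by simpa using hd 1
  -- All elements of the prime field are bounded by standard powers of two, hence by `d`.
  have hk : ∀ s ∈ Subfield.closure {ι (0 : M)}, |s| < ι d := by
    intro s hs
    obtain ⟨n, hn⟩ := abs_le_pow_of_mem_field hI hι hs
    have := hι (hd (2 ^ n))
    simp only [map_zero, zero_add, Nat.cast_pow, Nat.cast_ofNat, map_pow, map_ofNat] at hn this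
    exact hn.trans_lt this
  have hdc : DivisibleByClosure ι 0 d := by
    intro z hz hzS
    obtain ⟨n, hn⟩ := abs_le_pow_of_mem_closure hι hzS
    have h2 : z ≤ ((2 ^ n : ℕ) : M) := by
      rw [← hι.le_iff_le]
      simpa [abs_of_nonneg (map_nonneg_of_strictMono hι z), map_ofNat] using hn
    obtain ⟨m, rfl⟩ := exists_natCast_eq_of_le hI h2
    exact hdvd m (by exact_mod_cast hz)
  have hd1' : 1 < ι d := by simpa using hι hd1
  have hd2' : 2 < ι d := by
    have := hι (hd 2)
    rwa [map_natCast, Nat.cast_ofNat] at this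
  have hx : ι (d * d) ∉ nearMultiples ι e d := by
    rintro ⟨q, hq, s, hs, h⟩
    have hs' := (le_abs_self s).trans_lt (hk s hs)
    rw [map_mul] at h
    by_cases hqe : q * ι e = 0
    · rw [hqe, sub_zero, abs_of_nonneg (by positivity)] at h
      nlinarith
    · have he0 : e ≠ 0 := by rintro rfl; simp at hqe
      have hq0 : q ≠ 0 := by rintro rfl; simp at hqe
      have hqi := hk q⁻¹ (inv_mem hq)
      have h5 : ι d ^ 5 ≤ ι e := by
        rw [← map_pow]; exact hι.monotone (hdN.trans (hNe he0))
      have h1 : |q * ι e| ≤ 2 * (ι d * ι d) := by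
        have h3 := abs_sub_abs_le_abs_sub (q * ι e) (ι d * ι d)
        rw [abs_sub_comm] at h3
        rw [abs_of_nonneg (show 0 ≤ ι d * ι d by positivity)] at h3
        nlinarith
      have h2 : ι e = |q⁻¹| * |q * ι e| := by
        rw [← abs_mul, inv_mul_cancel_left₀ hq0, abs_of_nonneg (map_nonneg_of_strictMono hι e)]
      have h4 : ι e ≤ ι d ^ 4 := by
        calc ι e = |q⁻¹| * |q * ι e| := h2
          _ ≤ ι d * (ι d * (ι d * ι d)) := by
            refine mul_le_mul hqi.le (h1.trans ?_) (abs_nonneg _) (by linarith)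
            exact mul_le_mul_of_nonneg_right hd2'.le (by positivity)
          _ = ι d ^ 4 := by ring
      have : ι d ^ 4 < ι d ^ 5 := pow_lt_pow_right₀ hd1' (by norm_num)
      linarith
  obtain ⟨t, -, ht, htx, htd⟩ := exists_automorphism hι hdc (nearMultiples ι e d)
    (fun w ⟨s, hs, h⟩ => ⟨0, zero_mem _, s, hs, by simpa using h⟩) hx
  have h25 : d * d ≤ d ^ 5 := by
    rw [← pow_two]; exact pow_le_pow_right₀ hd1.le (by norm_num)
  refine ⟨t, ht 1 ⟨0, zero_mem _, 1, one_mem _, ?_⟩, ht e ⟨1, one_mem _, 0, zero_mem _, by simp⟩,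
    d * d, h25.trans (hdN.trans hNL), fun he0 => ?_, fun h => ?_⟩
  · simpa using hd1'.le
  · calc d * d * (d * d) = d ^ 4 := by ring
      _ < d ^ 5 := pow_lt_pow_right₀ hd1 (by norm_num)
      _ ≤ e := hdN.trans (hNe he0)
  · obtain ⟨s, hs, hs'⟩ := htd (d * d * (d * d))
    have hsd := (le_abs_self s).trans_lt (hk s hs)
    rw [h, htx] at hs'
    simp only [map_mul, map_add] at hs'
    have : s = 2 * (ι d * ι d) + ι d := by
      apply mul_right_cancel₀ (show ι d ≠ 0 by positivity)
      linear_combination -hs'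
    nlinarith

end Squares

/-! ### Automorphisms acting on digits -/

section Digits

set_option linter.unusedSectionVars false

variable {M : Type*} [CommSemiring M] [LinearOrder M] [IsStrictOrderedRing M]
  [CanonicallyOrderedAdd M] (hI : DefinableInduction peano M) {e : M} (he : 1 < e)

/-- The map that applies `t` to the last `n` digits in base `e`. -/
noncomputable def digitwise (t : M → M) : ℕ → M → M
  | 0, w => w
  | n + 1, w =>
    t (exists_div_mod hI w (zero_lt_one.trans he)).choose_spec.choose +
      e * digitwise t n (exists_div_mod hI w (zero_lt_one.trans he)).choose

theorem div_mod_unique (hI : DefinableInduction peano M) {q q' r r' : M} (hr : r < e)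
    (hr' : r' < e) (h : e * q + r = e * q' + r') : q = q' ∧ r = r' := by
  have main : ∀ {q q' r r' : M}, r < e → e * q + r = e * q' + r' → ¬ q < q' := by
    intro q q' r r' hr h hq
    have : e * q + r < e * q' + r' := by
      calc e * q + r < e * q + e := by gcongr
        _ = e * (q + 1) := by ring
        _ ≤ e * q' := by gcongr; exact add_one_le hI hq
        _ ≤ e * q' + r' := le_self_add
    exact this.ne h
  obtain rfl : q = q' := le_antisymm (not_lt.1 (main hr' h.symm)) (not_lt.1 (main hr h))
  exact ⟨rfl, add_left_cancel h⟩

theorem digitwise_succ (t : M → M) (n : ℕ) (q : M) {r : M} (hr : r < e) :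
    digitwise hI he t (n + 1) (e * q + r) = t r + e * digitwise hI he t n q := by
  have h := (exists_div_mod hI (e * q + r) (zero_lt_one.trans he)).choose_spec.choose_spec
  obtain ⟨h1, h2⟩ := div_mod_unique hI hr h.2 h.1
  rw [digitwise, ← h2, ← h1]

variable {hI he} {t : M ≃+o M}

theorem digitwise_zero (n : ℕ) : digitwise hI he t n 0 = 0 := by
  induction n with
  | zero => rfl
  | succ n ih =>
    have := digitwise_succ hI he t n 0 (zero_lt_one.trans he)
    simpa [ih] using this

theorem digitwise_one (h1 : t 1 = 1) (n : ℕ) : digitwise hI he t n 1 = 1 := by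
  cases n with
  | zero => rfl
  | succ n =>
    have := digitwise_succ hI he t n 0 he
    simpa [digitwise_zero, h1] using this

theorem lt_iff_of_fixed (hte : t e = e) {r : M} : t r < e ↔ r < e := by
  conv_lhs => rw [← hte]
  exact map_lt_map_iff t

theorem digitwise_add (h1 : t 1 = 1) (hte : t e = e) (n : ℕ) (x y : M) :
    digitwise hI he t n (x + y) = digitwise hI he t n x + digitwise hI he t n y := by
  induction n generalizing x y with
  | zero => rfl
  | succ n ih =>
    obtain ⟨q, r, rfl, hr⟩ := exists_div_mod hI x (zero_lt_one.trans he)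
    obtain ⟨q', r', rfl, hr'⟩ := exists_div_mod hI y (zero_lt_one.trans he)
    rw [digitwise_succ hI he t n q hr, digitwise_succ hI he t n q' hr']
    rcases lt_or_ge (r + r') e with h | h
    · rw [show e * q + r + (e * q' + r') = e * (q + q') + (r + r') by ring,
        digitwise_succ hI he t n _ h, ih, map_add]
      ring
    · -- The carry is respected since `t e = e`.
      obtain ⟨c, hc⟩ := exists_add_of_le h
      have hce : c < e := by
        by_contra! hce
        have : e + e ≤ r + r' := by rw [hc]; gcongr
        exact absurd this (not_le.2 (add_lt_add hr hr'))
      have ht : t r + t r' = e + t c := by rw [← map_add, hc, map_add, hte]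
      rw [show e * q + r + (e * q' + r') = e * (q + q' + 1) + c by
          rw [add_add_add_comm, hc]; ring,
        digitwise_succ hI he t n _ hce, ih, ih, digitwise_one h1]
      calc _ = (e + t c) + e * digitwise hI he t n q + e * digitwise hI he t n q' := by ring
        _ = _ := by rw [← ht]; ring

theorem digitwise_mul (n : ℕ) (w : M) :
    digitwise hI he t (n + 1) (e * w) = e * digitwise hI he t n w := by
  simpa using digitwise_succ hI he t n w (zero_lt_one.trans he)

theorem digitwise_pow (n : ℕ) : digitwise hI he t n (e ^ n) = e ^ n := by
  induction n with
  | zero => simp [digitwise]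
  | succ n ih => rw [pow_succ', digitwise_mul, ih]

theorem digitwise_symm (hte : t e = e) (n : ℕ) (w : M) :
    digitwise hI he t.symm n (digitwise hI he t n w) = w := by
  induction n generalizing w with
  | zero => rfl
  | succ n ih =>
    obtain ⟨q, r, rfl, hr⟩ := exists_div_mod hI w (zero_lt_one.trans he)
    rw [digitwise_succ hI he t n q hr, add_comm (t r),
      digitwise_succ hI he _ n _ ((lt_iff_of_fixed hte).2 hr), ih, add_comm]
    congr 1
    exact t.symm_apply_apply r

theorem digitwise_mono (h1 : t 1 = 1) (hte : t e = e) (n : ℕ) {x y : M} (h : x ≤ y) :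
    digitwise hI he t n x ≤ digitwise hI he t n y := by
  obtain ⟨c, rfl⟩ := exists_add_of_le h
  rw [digitwise_add h1 hte]
  exact le_self_add

theorem digitwise_eq_succ (n : ℕ) {w : M} (hw : w < e ^ n) :
    digitwise hI he t (n + 1) w = digitwise hI he t n w := by
  induction n generalizing w with
  | zero =>
    obtain rfl : w = 0 := by
      by_contra h
      exact absurd (one_le_of_ne_zero hI h) (not_le.2 (by simpa using hw))
    rw [digitwise_zero, digitwise_zero]
  | succ n ih =>
    obtain ⟨q, r, rfl, hr⟩ := exists_div_mod hI w (zero_lt_one.trans he)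
    rw [digitwise_succ hI he t _ q hr, digitwise_succ hI he t _ q hr, ih]
    by_contra! hq
    have : e ^ (n + 1) ≤ e * q + r := by
      rw [pow_succ']
      exact (mul_le_mul_right hq e).trans le_self_add
    exact absurd hw (not_lt.2 this)

theorem digitwise_eq_of_le {n m : ℕ} (hnm : n ≤ m) {w : M} (hw : w < e ^ n) :
    digitwise hI he t m w = digitwise hI he t n w := by
  induction m, hnm using Nat.le_induction with
  | base => rfl
  | succ m hm ih =>
    rw [digitwise_eq_succ m (hw.trans_le (pow_le_pow_right₀ he.le hm)), ih]

end Digits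

/-! ### Preservation of bounded formulas -/

section Bounded

set_option linter.unusedSectionVars false

variable {M : Type*} [CommSemiring M] [LinearOrder M] [IsStrictOrderedRing M]
  [CanonicallyOrderedAdd M]

/-- `N` is an initial segment of `M` closed under `0, 1, +` and the scalars `s`, and `σ` restricts
to an automorphism of the induced substructure. -/
structure SegmentAutomorphism {κ : Type} (s : κ → M) (N : Set M) (σ : M → M) : Prop where
  lower : ∀ x ∈ N, ∀ y ≤ x, y ∈ N
  one_mem : 1 ∈ N
  add_mem : ∀ x ∈ N, ∀ y ∈ N, x + y ∈ N
  mul_mem : ∀ i, ∀ x ∈ N, s i * x ∈ N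
  map_mem : ∀ x ∈ N, σ x ∈ N
  map_zero : σ 0 = 0
  map_one : σ 1 = 1
  map_add : ∀ x ∈ N, ∀ y ∈ N, σ (x + y) = σ x + σ y
  map_mul : ∀ i, ∀ x ∈ N, σ (s i * x) = s i * σ x
  le_iff : ∀ x ∈ N, ∀ y ∈ N, σ x ≤ σ y ↔ x ≤ y
  surj : ∀ y ∈ N, ∃ x ∈ N, σ x = y

theorem realize_bound {κ : Type} (s : κ → M) (i : κ) {α : Type} {n : ℕ} (v : α → M) (xs : Fin n → M)
    (x : M) :
    letI := scalarStructure s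
    (Term.lt (Term.var (Sum.inr (Fin.last n))) (tScalar i tOne)).Realize v
      (Fin.snoc xs x : Fin (n + 1) → M) ↔ x < s i := by
  let := scalarStructure s
  have hs := standardSymbols_lin s
  rw [Term.lt, BoundedFormula.realize_inf, BoundedFormula.realize_not, hs.realize_le,
    hs.realize_le, realize_tScalar, hs.realize_one, mul_one, ← lt_iff_le_not_ge]
  simp

namespace SegmentAutomorphism

variable {κ : Type} {s : κ → M} {N : Set M} {σ : M → M}

theorem inj (h : SegmentAutomorphism s N σ) {x y : M} (hx : x ∈ N) (hy : y ∈ N) :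
    σ x = σ y ↔ x = y := by
  simp only [le_antisymm_iff, h.le_iff x hx y hy, h.le_iff y hy x hx]

theorem lt_iff (h : SegmentAutomorphism s N σ) {x y : M} (hx : x ∈ N) (hy : y ∈ N) :
    σ x < σ y ↔ x < y := by
  rw [← not_le, ← not_le, h.le_iff y hy x hx]

theorem zero_mem (h : SegmentAutomorphism s N σ) : (0 : M) ∈ N := h.lower 1 h.one_mem 0 zero_le

theorem realize_term (h : SegmentAutomorphism s N σ) {α : Type*} (v : α → M) (hv : ∀ a, v a ∈ N)
    (t : (lin κ).Term α) :
    letI := scalarStructure s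
    t.realize v ∈ N ∧ t.realize (σ ∘ v) = σ (t.realize v) := by
  let := scalarStructure s
  induction t with
  | var a => exact ⟨hv a, rfl⟩
  | func f ts ih =>
    cases f with
    | zero => exact ⟨h.zero_mem, h.map_zero.symm⟩
    | one => exact ⟨h.one_mem, h.map_one.symm⟩
    | add =>
      refine ⟨h.add_mem _ (ih 0).1 _ (ih 1).1, ?_⟩
      refine Eq.trans ?_ (h.map_add _ (ih 0).1 _ (ih 1).1).symm
      rw [← (ih 0).2, ← (ih 1).2]
      rfl
    | scalar i =>
      refine ⟨h.mul_mem i _ (ih 0).1, ?_⟩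
      refine Eq.trans ?_ (h.map_mul i _ (ih 0).1).symm
      rw [← (ih 0).2]
      rfl

/-- Formulas whose quantifiers are bounded by an element of an initial segment are preserved by the
automorphisms of that segment. -/
theorem realize_iff (h : SegmentAutomorphism s N σ) {i : κ} {α : Type} {n : ℕ}
    {φ : (lin κ).BoundedFormula α n} (hφ : ScalarBounded i φ) (v : α → M) (hv : ∀ a, v a ∈ N)
    (xs : Fin n → M) (hxs : ∀ j, xs j ∈ N) :
    letI := scalarStructure s
    φ.Realize (σ ∘ v) (σ ∘ xs) ↔ φ.Realize v xs := by
  let := scalarStructure s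
  have hterm : ∀ {n : ℕ} (xs : Fin n → M) (_ : ∀ j, xs j ∈ N) (t : (lin κ).Term (α ⊕ Fin n)),
      t.realize (Sum.elim v xs) ∈ N ∧
        t.realize (Sum.elim (σ ∘ v) (σ ∘ xs)) = σ (t.realize (Sum.elim v xs)) := by
    intro n xs hxs t
    rw [← Sum.comp_elim]
    exact h.realize_term _ (by rintro (a | a); exacts [hv a, hxs a]) t
  have hsi : s i ∈ N := by simpa using h.mul_mem i 1 h.one_mem
  have hσi : σ (s i) = s i := by simpa [h.map_one] using h.map_mul i 1 h.one_mem
  have hsnoc : ∀ {n : ℕ} (xs : Fin n → M) (_ : ∀ j, xs j ∈ N) (x : M) (_ : x ∈ N),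
      ∀ j, (Fin.snoc xs x : Fin (n + 1) → M) j ∈ N := fun xs hxs x hx j => by
    refine Fin.lastCases ?_ (fun j => ?_) j
    · simpa using hx
    · simpa using hxs j
  have hcomp : ∀ {n : ℕ} (xs : Fin n → M) (x : M),
      σ ∘ (Fin.snoc xs x : Fin (n + 1) → M) = Fin.snoc (σ ∘ xs) (σ x) := fun xs x =>
    Fin.comp_snoc σ xs x
  induction hφ with
  | falsum => exact Iff.rfl
  | equal t₁ t₂ =>
    refine Iff.trans (iff_of_eq (congrArg₂ (· = ·) (hterm xs hxs t₁).2 (hterm xs hxs t₂).2)) ?_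
    exact h.inj (hterm xs hxs t₁).1 (hterm xs hxs t₂).1
  | rel R ts =>
    cases R with
    | le =>
      refine Iff.trans (iff_of_eq
        (congrArg₂ (· ≤ ·) (hterm xs hxs (ts 0)).2 (hterm xs hxs (ts 1)).2)) ?_
      exact h.le_iff _ (hterm xs hxs (ts 0)).1 _ (hterm xs hxs (ts 1)).1
  | imp _ _ h₁ h₂ =>
    exact imp_congr (h₁ xs hxs) (h₂ xs hxs)
  | ball _ ih =>
    have ih' := fun x hx => hcomp xs x ▸ ih _ (hsnoc xs hxs x hx)
    simp only [BoundedFormula.realize_all, BoundedFormula.realize_imp, realize_bound]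
    constructor
    · intro H x hx
      have hxN := h.lower _ hsi x hx.le
      refine (ih' x hxN).1 (H (σ x) ?_)
      rwa [← hσi, h.lt_iff hxN hsi]
    · intro H y hy
      obtain ⟨x, hx, rfl⟩ := h.surj y (h.lower _ hsi y hy.le)
      refine (ih' x hx).2 (H x ?_)
      rwa [← hσi, h.lt_iff hx hsi] at hy
  | bex _ ih =>
    have ih' := fun x hx => hcomp xs x ▸ ih _ (hsnoc xs hxs x hx)
    simp only [BoundedFormula.realize_ex, BoundedFormula.realize_inf, realize_bound]
    constructor
    · rintro ⟨y, hy, H⟩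
      obtain ⟨x, hx, rfl⟩ := h.surj y (h.lower _ hsi y hy.le)
      rw [← hσi, h.lt_iff hx hsi] at hy
      exact ⟨x, hy, (ih' x hx).1 H⟩
    · rintro ⟨x, hx, H⟩
      have hxN := h.lower _ hsi x hx.le
      exact ⟨σ x, by rwa [← hσi, h.lt_iff hxN hsi], (ih' x hxN).2 H⟩

theorem not_mulDefinableUpTo {a b : M} (h : SegmentAutomorphism ![a, b] N σ) {L x : M}
    (hx : x ∈ N) (hxx : x * x ∈ N) (hxL : x ≤ L) (hne : σ (x * x) ≠ σ x * σ x) :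
    ¬ MulDefinableUpTo L a b := by
  rintro ⟨φ, hφ, H⟩
  let := scalarStructure ![a, b]
  have hmem : ∀ j, ![x, x, x * x] j ∈ N := by
    intro j
    fin_cases j
    exacts [hx, hx, hxx]
  have h1 : φ.Realize ![x, x, x * x] := (H x x (x * x)).2 ⟨hxL, hxL, rfl⟩
  have h2 : φ.Realize (σ ∘ ![x, x, x * x]) := by
    have := h.realize_iff hφ _ hmem default (fun j => j.elim0)
    rw [Formula.Realize, ← this] at h1
    rw [Formula.Realize]
    convert h1
  have h3 : σ ∘ ![x, x, x * x] = ![σ x, σ x, σ (x * x)] := by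
    funext j
    fin_cases j <;> rfl
  rw [h3, H] at h2
  exact hne h2.2.2

end SegmentAutomorphism

end Bounded

/-! ### Multiplication is not definable if the scalars are algebraically dependent -/

section NotDefinable

set_option linter.unusedSectionVars false

variable {M : Type*} [CommSemiring M] [LinearOrder M] [IsStrictOrderedRing M]
  [CanonicallyOrderedAdd M] {K : Type*} [Field K] [LinearOrder K] [IsStrictOrderedRing K]
  {ι : M →+* K}

/-- An automorphism of a segment that commutes with `e` commutes with all scalars in `ℚ(e)`. -/
theorem SegmentAutomorphism.map_mul_of_mem_closure (hι : StrictMono ι) {e f : M} {N : Set M}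
    {σ : M → M} (h : SegmentAutomorphism (fun _ : Unit => e) N σ)
    (hf : ι f ∈ Subfield.closure {ι e}) (hfN : ∀ x ∈ N, f * x ∈ N) {w : M} (hw : w ∈ N) :
    σ (f * w) = f * σ w := by
  let P : M → Prop := fun u => ∀ x ∈ N, u * x ∈ N ∧ σ (u * x) = u * σ x
  have hP : ∀ m ∈ Subring.closure {ι e}, ∃ u v : M, P u ∧ P v ∧ m = ι u - ι v := by
    have hadd : ∀ u v, P u → P v → P (u + v) := fun u v hu hv x hx => by
      rw [add_mul, add_mul, h.map_add _ (hu x hx).1 _ (hv x hx).1, (hu x hx).2, (hv x hx).2]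
      exact ⟨h.add_mem _ (hu x hx).1 _ (hv x hx).1, rfl⟩
    have hmul : ∀ u v, P u → P v → P (u * v) := fun u v hu hv x hx => by
      rw [mul_assoc, mul_assoc, ← (hv x hx).2]
      exact hu _ (hv x hx).1
    have h0 : P 0 := fun x hx => by simp [h.zero_mem, h.map_zero]
    have h1 : P 1 := fun x hx => by simp [hx]
    intro m hm
    induction hm using Subring.closure_induction with
    | mem x hx => exact ⟨e, 0, fun x hx => ⟨h.mul_mem () x hx, h.map_mul () x hx⟩, h0, by
        simpa using hx⟩
    | zero => exact ⟨0, 0, h0, h0, by simp⟩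
    | one => exact ⟨1, 0, h1, h0, by simp⟩
    | add _ _ _ _ h₁ h₂ =>
      obtain ⟨x, y, hx, hy, rfl⟩ := h₁
      obtain ⟨z, w, hz, hw, rfl⟩ := h₂
      exact ⟨x + z, y + w, hadd _ _ hx hz, hadd _ _ hy hw, by simp only [_root_.map_add]; ring⟩
    | neg _ _ h =>
      obtain ⟨x, y, hx, hy, rfl⟩ := h
      exact ⟨y, x, hy, hx, by ring⟩
    | mul _ _ _ _ h₁ h₂ =>
      obtain ⟨x, y, hx, hy, rfl⟩ := h₁
      obtain ⟨z, w, hz, hw, rfl⟩ := h₂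
      exact ⟨x * z + y * w, x * w + y * z, hadd _ _ (hmul _ _ hx hz) (hmul _ _ hy hw),
        hadd _ _ (hmul _ _ hx hw) (hmul _ _ hy hz), by simp only [_root_.map_add, _root_.map_mul]; ring⟩
  obtain ⟨y, hy, z, hz, hyz⟩ := Subfield.mem_closure_iff.1 hf
  rcases eq_or_ne z 0 with rfl | hz0
  · obtain rfl : f = 0 := hι.injective (by rw [← hyz]; simp)
    simp [h.map_zero]
  obtain ⟨u, v, hu, hv, rfl⟩ := hP y hy
  obtain ⟨u', v', hu', hv', rfl⟩ := hP z hz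
  rw [div_eq_iff hz0] at hyz
  -- The relation `f (u' - v') = u - v`, written without subtraction, is applied to `w`.
  have hrel : f * u' + v = u + f * v' := hι.injective (by
    simp only [_root_.map_add, _root_.map_mul]; linear_combination -hyz)
  have h1 : σ (u' * (f * w) + v * w) = σ (u * w + v' * (f * w)) := by
    rw [show u' * (f * w) + v * w = (f * u' + v) * w by ring, hrel]
    ring_nf
  have hfw := hfN w hw
  rw [h.map_add _ (hu' _ hfw).1 _ (hv w hw).1, h.map_add _ (hu w hw).1 _ (hv' _ hfw).1,
    (hu' _ hfw).2, (hv w hw).2, (hu w hw).2, (hv' _ hfw).2] at h1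
  apply hι.injective
  apply mul_left_cancel₀ hz0
  have h2 := congrArg ι h1
  simp only [_root_.map_add, _root_.map_mul] at h2 ⊢
  linear_combination h2 + ι (σ w) * hyz

variable (hI : DefinableInduction peano M) {e : M} (he : 1 < e)

open Classical in
/-- The map that applies `t` to all digits in base `e` of an element below a standard power
of `e`. -/
noncomputable def digitLimit (t : M → M) (w : M) : M :=
  if h : ∃ n : ℕ, w < e ^ n then digitwise hI he t h.choose w else w

variable {hI he} {t : M ≃+o M}

theorem digitLimit_eq {n : ℕ} {w : M} (hw : w < e ^ n) :
    digitLimit hI he t w = digitwise hI he t n w := by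
  have h : ∃ n : ℕ, w < e ^ n := ⟨n, hw⟩
  rw [digitLimit, dif_pos h]
  rcases le_total h.choose n with hn | hn
  · exact (digitwise_eq_of_le hn h.choose_spec).symm
  · exact digitwise_eq_of_le hn hw

theorem segmentAutomorphism_digitLimit (h1 : t 1 = 1) (hte : t e = e) :
    SegmentAutomorphism (fun _ : Unit => e) {w : M | ∃ n : ℕ, w < e ^ n}
      (digitLimit hI he t) := by
  have hlt : ∀ (t : M ≃+o M) (_ : t 1 = 1) (_ : t e = e) (n : ℕ) (w : M), w < e ^ n →
      digitwise hI he t n w < e ^ n := by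
    intro t h1 hte n w hw
    rw [← digitwise_pow (hI := hI) (he := he) (t := t) n]
    refine lt_of_le_of_ne (digitwise_mono h1 hte n hw.le) fun h => hw.ne ?_
    have := congrArg (digitwise hI he t.symm n) h
    rwa [digitwise_symm hte, digitwise_symm hte] at this
  have hstep : ∀ {n m : ℕ} (_ : n ≤ m) {w : M}, w < e ^ n → w < e ^ m := fun h _ hw =>
    hw.trans_le (pow_le_pow_right₀ he.le h)
  have h1s : t.symm 1 = 1 := by
    have := t.symm_apply_apply 1
    rwa [h1] at this
  have htes : t.symm e = e := by
    have := t.symm_apply_apply e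
    rwa [hte] at this
  have h2e : (2 : M) ≤ e := by
    have := add_one_le hI he
    rwa [one_add_one_eq_two] at this
  exact
    { lower := fun x ⟨n, hn⟩ y hy => ⟨n, hy.trans_lt hn⟩
      one_mem := ⟨1, by simpa using he⟩
      add_mem := by
        rintro x ⟨n, hn⟩ y ⟨m, hm⟩
        refine ⟨n + m + 1, ?_⟩
        calc x + y < e ^ (n + m) + e ^ (n + m) :=
              add_lt_add (hstep (by omega) hn) (hstep (by omega) hm)
          _ = 2 * e ^ (n + m) := by ring
          _ ≤ e * e ^ (n + m) := by gcongr
          _ = e ^ (n + m + 1) := by ring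
      mul_mem := by
        rintro - x ⟨n, hn⟩
        refine ⟨n + 1, ?_⟩
        rw [pow_succ']
        gcongr
      map_mem := by
        rintro x ⟨n, hn⟩
        rw [digitLimit_eq hn]
        exact ⟨n, hlt t h1 hte n x hn⟩
      map_zero := by
        rw [digitLimit_eq (n := 0) (by simp), digitwise_zero]
      map_one := by
        rw [digitLimit_eq (n := 1) (by simpa using he), digitwise_one h1]
      map_add := by
        rintro x ⟨n, hn⟩ y ⟨m, hm⟩
        have hx := hstep (show n ≤ n + m + 1 by omega) hn
        have hy := hstep (show m ≤ n + m + 1 by omega) hm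
        have hxy : x + y < e ^ (n + m + 1) := by
          calc x + y < e ^ (n + m) + e ^ (n + m) :=
                add_lt_add (hstep (by omega) hn) (hstep (by omega) hm)
            _ = 2 * e ^ (n + m) := by ring
            _ ≤ e * e ^ (n + m) := by gcongr
            _ = e ^ (n + m + 1) := by ring
        rw [digitLimit_eq hxy, digitLimit_eq hx, digitLimit_eq hy, digitwise_add h1 hte]
      map_mul := by
        rintro - x ⟨n, hn⟩
        have hx : e * x < e ^ (n + 1) := by
          rw [pow_succ']
          gcongr
        rw [digitLimit_eq hx, digitLimit_eq hn, digitwise_mul]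
      le_iff := by
        rintro x ⟨n, hn⟩ y ⟨m, hm⟩
        rw [digitLimit_eq (hstep (show n ≤ n + m by omega) hn),
          digitLimit_eq (hstep (show m ≤ n + m by omega) hm)]
        refine ⟨fun h => ?_, digitwise_mono h1 hte _⟩
        have := digitwise_mono (hI := hI) (he := he) h1s htes (n + m) h
        rwa [digitwise_symm hte, digitwise_symm hte] at this
      surj := by
        rintro y ⟨n, hn⟩
        refine ⟨digitwise hI he t.symm n y, ⟨n, hlt _ h1s htes n y hn⟩, ?_⟩
        rw [digitLimit_eq (hlt _ h1s htes n y hn)]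
        exact digitwise_symm (t := t.symm) htes n y }

/-- If one of the scalars `a, b` is rational in the other one, then no bounded formula without
parameters defines multiplication up to a non-standard element. -/
theorem not_mulDefinableUpTo (hI : DefinableInduction peano M) (hM : ∃ x : M, IsNonstandard x)
    (hι : StrictMono ι) {a b L : M} (hL : IsNonstandard L) {e f : M}
    (hf : ι f ∈ Subfield.closure {ι e}) (hs : ∀ i, ![a, b] i = e ∨ ![a, b] i = f) :
    ¬ MulDefinableUpTo L a b := by
  have hfpow : ∃ n : ℕ, f ≤ (e + 2) ^ n := by
    obtain ⟨n, hn⟩ := abs_le_pow_of_mem_field hI hι hf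
    refine ⟨n, ?_⟩
    rw [← hι.le_iff_le]
    simpa [abs_of_nonneg (map_nonneg_of_strictMono hι f), map_ofNat] using hn
  obtain ⟨n, hn⟩ := hfpow
  by_cases he : IsNonstandard e
  · have he1 : 1 < e := by simpa using he.natCast_lt hI 1
    obtain ⟨t, ht1, hte, x, hxL, hxe, hne⟩ :=
      exists_automorphism_sq_ne hI hM hι hL (Or.inr he)
    have hσ := segmentAutomorphism_digitLimit (hI := hI) (he := he1) ht1 hte
    have hfN : ∀ w ∈ {w : M | ∃ n : ℕ, w < e ^ n}, f * w ∈ {w : M | ∃ n : ℕ, w < e ^ n} := by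
      rintro w ⟨m, hm⟩
      have h3 : (3 : M) ≤ e := by simpa using (he.natCast_lt hI 3).le
      have h2 : e + 2 ≤ e ^ 2 := by
        calc e + 2 ≤ e + (e + e) := by
              gcongr
              calc (2 : M) = 1 + 1 := one_add_one_eq_two.symm
                _ ≤ e + e := add_le_add he1.le he1.le
          _ = 3 * e := by ring
          _ ≤ e * e := by gcongr
          _ = e ^ 2 := by ring
      refine ⟨2 * n + m + 1, ?_⟩
      calc f * w ≤ (e ^ 2) ^ n * e ^ m :=
            mul_le_mul' (hn.trans (pow_le_pow_left₀ zero_le h2 n)) hm.le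
        _ = e ^ (2 * n + m) := by ring
        _ < e ^ (2 * n + m + 1) := pow_lt_pow_right₀ he1 (by omega)
    have hσ' : SegmentAutomorphism ![a, b] {w : M | ∃ n : ℕ, w < e ^ n}
        (digitLimit hI he1 t) :=
      { hσ with
        mul_mem := fun i x hx => by
          rcases hs i with h | h <;> rw [h]
          exacts [hσ.mul_mem () x hx, hfN x hx]
        map_mul := fun i x hx => by
          rcases hs i with h | h <;> rw [h]
          exacts [hσ.map_mul () x hx, hσ.map_mul_of_mem_closure hι hf hfN hx] }
    have hxx : x * x < e := hxe (zero_lt_one.trans he1).ne'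
    have hx : x < e := by
      rcases eq_or_ne x 0 with rfl | hx0
      · exact zero_lt_one.trans he1
      · exact (le_mul_of_one_le_left zero_le (one_le_of_ne_zero hI hx0)).trans_lt hxx
    have hdig : ∀ r < e, digitLimit hI he1 t r = t r := fun r hr => by
      rw [digitLimit_eq (n := 1) (by simpa using hr)]
      have := digitwise_succ hI he1 t 0 0 hr
      simpa [digitwise_zero] using this
    refine hσ'.not_mulDefinableUpTo ⟨1, by simpa using hx⟩ ⟨1, by simpa using hxx⟩ hxL ?_
    rwa [hdig _ hx, hdig _ hxx]
  · rw [isNonstandard_iff] at he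
    push Not at he
    obtain ⟨m, rfl⟩ := he
    obtain ⟨k, rfl⟩ : ∃ k : ℕ, f = k :=
      exists_natCast_eq_of_le hI (n := (m + 2) ^ n) (by exact_mod_cast hn)
    obtain ⟨t, ht1, -, x, hxL, -, hne⟩ :=
      exists_automorphism_sq_ne hI hM hι hL (Or.inl rfl)
    have hnat : ∀ (k : ℕ) (w : M), t (k * w) = k * t w := fun k w => by
      rw [← nsmul_eq_mul, ← nsmul_eq_mul, map_nsmul]
    have hσ : SegmentAutomorphism ![a, b] Set.univ t :=
      { lower := fun _ _ _ _ => trivial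
        one_mem := trivial
        add_mem := fun _ _ _ _ => trivial
        mul_mem := fun _ _ _ => trivial
        map_mem := fun _ _ => trivial
        map_zero := map_zero t
        map_one := ht1
        map_add := fun x _ y _ => map_add t x y
        map_mul := fun i x _ => by
          rcases hs i with h | h <;> rw [h] <;> exact hnat _ x
        le_iff := fun x _ y _ => map_le_map_iff t
        surj := fun y _ => ⟨t.symm y, trivial, t.apply_symm_apply y⟩ }
    exact hσ.not_mulDefinableUpTo trivial trivial hxL hne

/-- If multiplication up to a non-standard element is definable by a bounded formula without
parameters, then no scalar is definable from the other one. -/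
theorem models_LAStrict (hI : DefinableInduction peano M) (hM : ∃ x : M, IsNonstandard x)
    {a b L : M} (hL : IsNonstandard L) (h : MulDefinableUpTo L a b) :
    ModelsTwo a b (LAStrict (Fin 2)) := by
  obtain ⟨K, _, _, _, ι, hι⟩ := exists_orderedField M
  let := scalarStructure ![a, b]
  change M ⊨ LAStrict (Fin 2)
  rw [LAStrict, Theory.model_union_iff]
  refine ⟨models_LA hI _, (Theory.model_iff _).2 fun ψ hψ => ?_⟩
  simp only [Set.mem_iUnion, Set.mem_range] at hψ
  obtain ⟨i, n, φ, rfl⟩ := hψ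
  by_contra hφ
  have key : ∀ e, (∀ j ≠ i, ![a, b] j = e) → False := fun e he =>
    not_mulDefinableUpTo hI hM hι hL
      (mem_closure_of_not_models_axStrict hI hM hι ![a, b] i he φ hφ)
      (fun j => (eq_or_ne j i).elim (fun h => Or.inr (by rw [h])) fun h => Or.inl (he j h)) h
  fin_cases i
  · exact key b fun j hj => by fin_cases j <;> simp_all
  · exact key a fun j hj => by fin_cases j <;> simp_all

end NotDefinable

/-! ### Record minima of remainders and continued fractions -/

section Records

set_option linter.unusedSectionVars false

variable {M : Type*} [CommSemiring M] [LinearOrder M]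

/-- `v` is the remainder of `r * y` modulo `m`, for an argument `y < m`. -/
def IsRemainder (r m y v : M) : Prop := y < m ∧ v < m ∧ ∃ q, r * y = m * q + v

/-- `x` is a record of the map sending `y` to the remainder of `r * y` modulo `m`: among the
arguments `0 < y ≤ x`, the least remainder is attained at `x` only. -/
def IsRecord (r m x : M) : Prop :=
  0 < x ∧ ∃ v, IsRemainder r m x v ∧ ∀ y u, 0 < y → y < x → IsRemainder r m y u → v < u

/-- The fractions `r / m > r' / m'` are neighbours, as consecutive convergents of a continued
fraction are. -/
structure NeighbourFractions (r m r' m' : M) : Prop where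
  det : r * m' = r' * m + 1
  pos : 0 < m'
  one_lt : 1 < m

variable [IsStrictOrderedRing M] [CanonicallyOrderedAdd M]

theorem IsRemainder.unique (hI : DefinableInduction peano M) {r m y v v' : M}
    (h : IsRemainder r m y v) (h' : IsRemainder r m y v') : v = v' := by
  obtain ⟨-, hv, q, hq⟩ := h
  obtain ⟨-, hv', q', hq'⟩ := h'
  exact (div_mod_unique hI hv hv' (hq.symm.trans hq')).2

theorem exists_isRemainder (hI : DefinableInduction peano M) (r : M) {m y : M} (h : y < m) :
    ∃ v, IsRemainder r m y v := by
  obtain ⟨q, v, hq, hv⟩ := exists_div_mod hI (r * y) (pos_of_gt h)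
  exact ⟨v, h, hv, q, hq⟩

theorem isRemainder_add_mul_iff (hI : DefinableInduction peano M) {r m k y v : M} :
    IsRemainder (r + m * k) m y v ↔ IsRemainder r m y v := by
  have key : ∀ v, IsRemainder r m y v → IsRemainder (r + m * k) m y v := by
    rintro v ⟨h, hv, q, hq⟩
    exact ⟨h, hv, q + k * y, by rw [add_mul, hq]; ring⟩
  refine ⟨fun h => ?_, key v⟩
  obtain ⟨u, hu⟩ := exists_isRemainder hI r h.1
  rwa [h.unique hI (key u hu)]

theorem isRecord_add_mul_iff (hI : DefinableInduction peano M) {r m k x : M} :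
    IsRecord (r + m * k) m x ↔ IsRecord r m x := by
  simp only [IsRecord, isRemainder_add_mul_iff hI]

namespace NeighbourFractions

variable {r m r' m' c r₁ m₁ : M}

theorem remainder_pos (hI : DefinableInduction peano M) (h : NeighbourFractions r m r' m')
    {x v : M} (hx : 0 < x) (hv : IsRemainder r m x v) : 0 < v := by
  obtain ⟨hxm, -, q, hq⟩ := hv
  refine pos_of_ne_zero fun h0 => ?_
  rw [h0, add_zero] at hq
  -- Modulo `m`, the number `m'` is an inverse of `r`.
  have h1 : m * (m' * q) = m * (r' * x) + x := by
    rw [mul_left_comm, ← hq, show m' * (r * x) = r * m' * x by ring, h.det]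
    ring
  rcases le_or_gt (m' * q) (r' * x) with h2 | h2
  · have : m * (m' * q) ≤ m * (r' * x) := by gcongr
    rw [h1] at this
    exact absurd this (not_le.2 (lt_add_of_pos_right _ hx))
  · have : m * (r' * x + 1) ≤ m * (m' * q) := by
      gcongr
      exact add_one_le hI h2
    rw [h1, mul_add, mul_one] at this
    exact absurd (le_of_add_le_add_left this) (not_le.2 hxm)

/-- Passing to the next convergent essentially multiplies the remainders by `c`. -/
theorem remainder_step (hI : DefinableInduction peano M) (h : NeighbourFractions r m r' m')
    (hr : r₁ + r' = c * r) (hm : m₁ + m' = c * m) (hc : m' < c) {x v : M} (hx : 0 < x)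
    (hv : IsRemainder r m x v) :
    ∃ w, IsRemainder r₁ m₁ x w ∧ w ≤ c * v ∧ c * v < w + m' := by
  obtain ⟨hxm, hvm, q, hq⟩ := hv
  have hm0 : 0 < m := pos_of_gt hxm
  have e1 : m * (m' * q + c * v) + m' * v = m * (r' * x) + m * (c * v) + x := by
    have : m' * (m * q + v) = m * (r' * x) + x := by
      rw [← hq, show m' * (r * x) = r * m' * x by ring, h.det]
      ring
    rw [show m * (m' * q + c * v) + m' * v = m' * (m * q + v) + m * (c * v) by ring, this]
    ring
  have hvc : m' * v ≤ m * (c * v) := by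
    calc m' * v ≤ c * v := by gcongr
      _ = 1 * (c * v) := (one_mul _).symm
      _ ≤ m * (c * v) := by gcongr; exact h.one_lt.le
  have h1 : r' * x ≤ m' * q + c * v := by
    by_contra! h1
    have h2 : m * (m' * q + c * v) < m * (r' * x) := by gcongr
    have := add_lt_add_of_lt_of_le h2 hvc
    rw [e1] at this
    exact absurd this (not_lt.2 le_self_add)
  obtain ⟨w, hw⟩ := exists_add_of_le h1
  have e2 : m * w + m' * v = m * (c * v) + x := by
    rw [hw] at e1
    apply add_left_cancel (a := m * (r' * x))
    rw [← add_assoc, ← mul_add, e1, add_assoc]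
  have hwc : w ≤ c * v := by
    by_contra! h2
    have h3 : m * (c * v + 1) ≤ m * w := by gcongr; exact add_one_le hI h2
    have h4 : m * (c * v) + x < m * w := by
      rw [mul_add, mul_one] at h3
      exact lt_of_lt_of_le (by gcongr) h3
    rw [← e2] at h4
    exact absurd h4 (not_lt.2 le_self_add)
  have hcw : c * v < w + m' := by
    have h2 : m * (c * v) < m * (w + m') := by
      calc m * (c * v) < m * (c * v) + x := lt_add_of_pos_right _ hx
        _ = m * w + m' * v := e2.symm
        _ ≤ m * w + m' * m := by gcongr
        _ = m * (w + m') := by ring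
    exact lt_of_mul_lt_mul_left h2 hm0.le
  have hwm : w < m₁ := by
    have h2 : w + m' < m₁ + m' := by
      calc w + m' < c * v + c := add_lt_add_of_le_of_lt hwc hc
        _ = c * (v + 1) := by ring
        _ ≤ c * m := by gcongr; exact add_one_le hI hvm
        _ = m₁ + m' := hm.symm
    exact lt_of_add_lt_add_right h2
  have hmm : m ≤ m₁ := by
    have h2 : m + m' ≤ m₁ + m' := by
      calc m + m' ≤ m + m * m' := by gcongr; exact le_mul_of_one_le_left zero_le h.one_lt.le
        _ = (m' + 1) * m := by ring
        _ ≤ c * m := by gcongr; exact add_one_le hI hc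
        _ = m₁ + m' := hm.symm
    exact le_of_add_le_add_right h2
  refine ⟨w, ⟨hxm.trans_le hmm, hwm, q, ?_⟩, hwc, hcw⟩
  apply add_right_cancel (b := r' * x)
  rw [← add_mul, hr, mul_assoc, hq, mul_add, ← mul_assoc, ← hm, add_mul, add_assoc, hw]
  ring

/-- Passing to the next convergent adds exactly one record, the previous denominator. -/
theorem isRecord_step (hI : DefinableInduction peano M) (h : NeighbourFractions r m r' m')
    (hr : r₁ + r' = c * r) (hm : m₁ + m' = c * m) (hc : m' < c)
    (h₁ : NeighbourFractions r₁ m₁ r m) (hmm : m < m₁) {x : M} :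
    IsRecord r₁ m₁ x ↔ IsRecord r m x ∨ x = m := by
  have step := fun {x v : M} (hx : 0 < x) (hv : IsRemainder r m x v) =>
    h.remainder_step hI hr hm hc hx hv
  have hlast : IsRemainder r₁ m₁ m 1 := ⟨hmm, h₁.one_lt, r, by rw [h₁.det]; ring⟩
  have hone : ∀ {x w}, 0 < x → x < m → IsRemainder r₁ m₁ x w → 1 < w := by
    intro x w hx hxm hw
    obtain ⟨v, hv⟩ := exists_isRemainder hI r hxm
    obtain ⟨w', hw', -, h2⟩ := step hx hv
    rw [hw.unique hI hw']
    have h3 : m' + 1 < w' + m' := by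
      calc m' + 1 ≤ c := add_one_le hI hc
        _ = c * 1 := (mul_one c).symm
        _ ≤ c * v := by gcongr; exact one_le_of_ne_zero hI (h.remainder_pos hI hx hv).ne'
        _ < _ := h2
    rw [add_comm] at h3
    exact lt_of_add_lt_add_right h3
  have hmono : ∀ {x y v u w t}, 0 < x → 0 < y → IsRemainder r m x v → IsRemainder r m y u →
      IsRemainder r₁ m₁ x w → IsRemainder r₁ m₁ y t → v < u → w < t := by
    intro x y v u w t hx hy hv hu hw ht hvu
    obtain ⟨w', hw', h2, -⟩ := step hx hv
    obtain ⟨t', ht', -, h3⟩ := step hy hu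
    rw [hw.unique hI hw', ht.unique hI ht']
    have h4 : w' + m' < t' + m' := by
      calc w' + m' < c * v + c := add_lt_add_of_le_of_lt h2 hc
        _ = c * (v + 1) := by ring
        _ ≤ c * u := by gcongr; exact add_one_le hI hvu
        _ < _ := h3
    exact lt_of_add_lt_add_right h4
  have hiff : ∀ {x y v u w t}, 0 < x → 0 < y → IsRemainder r m x v → IsRemainder r m y u →
      IsRemainder r₁ m₁ x w → IsRemainder r₁ m₁ y t → w < t → v < u := by
    intro x y v u w t hx hy hv hu hw ht hwt
    by_contra! huv
    rcases huv.lt_or_eq with h2 | rfl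
    · exact lt_asymm hwt (hmono hy hx hu hv ht hw h2)
    · -- Equal remainders at `x` and `y` would force `x = y`.
      have : ∀ {x y q p : M}, x < y → y < m → r * x = m * q + u → r * y = m * p + u → False := by
        intro x y q p hxy hym hq hp
        obtain ⟨d, rfl⟩ := exists_add_of_le hxy.le
        have hd : 0 < d := pos_of_ne_zero fun h0 => by simp [h0] at hxy
        have hdm : d < m := lt_of_le_of_lt le_add_self hym
        have hqp : q ≤ p := by
          by_contra! h3
          have h4 : r * x ≤ r * (x + d) := by gcongr
          rw [hq, hp] at h4
          have h5 : m * p < m * q := mul_lt_mul_of_pos_left h3 (pos_of_gt hdm)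
          exact absurd (le_of_add_le_add_right h4) (not_le.2 h5)
        obtain ⟨k, rfl⟩ := exists_add_of_le hqp
        have h3 : r * d = m * k := by
          apply add_left_cancel (a := r * x)
          rw [← mul_add, hp, hq]
          ring
        exact (h.remainder_pos hI hd ⟨hdm, pos_of_gt hdm, k, by rw [h3, add_zero]⟩).ne rfl
      obtain ⟨hxm, -, q, hq⟩ := hv
      obtain ⟨hym, -, p, hp⟩ := hu
      rcases lt_trichotomy x y with h3 | rfl | h3
      · exact this h3 hym hq hp
      · exact hwt.ne (hw.unique hI ht)
      · exact this h3 hxm hp hq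
  constructor
  · rintro ⟨hx, w, hw, hmin⟩
    rcases lt_trichotomy x m with hxm | rfl | hxm
    · left
      obtain ⟨v, hv⟩ := exists_isRemainder hI r hxm
      refine ⟨hx, v, hv, fun y u hy hyx hu => ?_⟩
      obtain ⟨t, ht, -⟩ := step hy hu
      exact hiff hx hy hv hu hw ht (hmin y t hy hyx ht)
    · exact Or.inr rfl
    · exact absurd (hmin m 1 (pos_of_gt h.one_lt) hxm hlast)
        (not_lt.2 (one_le_of_ne_zero hI (h₁.remainder_pos hI hx hw).ne'))
  · rintro (⟨hx, v, hv, hmin⟩ | rfl)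
    · obtain ⟨w, hw, -⟩ := step hx hv
      refine ⟨hx, w, hw, fun y t hy hyx ht => ?_⟩
      obtain ⟨u, hu⟩ := exists_isRemainder hI r (hyx.trans hv.1)
      exact hmono hx hy hv hu hw ht (hmin y u hy hyx hu)
    · exact ⟨pos_of_gt h.one_lt, 1, hlast, fun y u hy hyx hu => hone hy hyx hu⟩

theorem exists_step (hI : DefinableInduction peano M) (h : NeighbourFractions r m r' m')
    (hc : m' < c) :
    ∃ r₁ m₁, m₁ + m' = c * m ∧ NeighbourFractions r₁ m₁ r m ∧
      ∀ x, IsRecord r₁ m₁ x ↔ IsRecord r m x ∨ x = m := by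
  have hm0 : 0 < m := pos_of_gt h.one_lt
  have h1 : r' ≤ c * r := by
    calc r' = r' * 1 := (mul_one _).symm
      _ ≤ r' * m := by gcongr; exact h.one_lt.le
      _ ≤ r' * m + 1 := le_self_add
      _ = r * m' := h.det.symm
      _ ≤ r * c := by gcongr
      _ = c * r := mul_comm _ _
  have h2 : (m' + 1) * m ≤ c * m := by gcongr; exact add_one_le hI hc
  have h3 : m + m' < (m' + 1) * m := by
    calc m + m' < m + m' * m := by gcongr; exact lt_mul_of_one_lt_right h.pos h.one_lt
      _ = _ := by ring
  obtain ⟨r₁, hr⟩ := exists_add_of_le h1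
  obtain ⟨m₁, hm⟩ := exists_add_of_le ((le_add_self.trans h3.le).trans h2)
  rw [add_comm] at hr hm
  have hmm : m < m₁ := by
    have := h3.trans_le h2
    rw [hm] at this
    exact lt_of_add_lt_add_right this
  have h₁ : NeighbourFractions r₁ m₁ r m := by
    refine ⟨?_, hm0, h.one_lt.trans hmm⟩
    apply add_right_cancel (b := r * m')
    calc r₁ * m + r * m' = (r₁ + r') * m + 1 := by rw [h.det]; ring
      _ = r * (c * m) + 1 := by rw [← hr]; ring
      _ = r * m₁ + 1 + r * m' := by rw [hm]; ring
  exact ⟨r₁, m₁, hm.symm, h₁, fun x => h.isRecord_step hI hr.symm hm.symm hc h₁ hmm⟩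

end NeighbourFractions

theorem neighbourFractions_one {m : M} (h : 1 < m) : NeighbourFractions 1 m 0 1 :=
  ⟨by simp, one_pos, h⟩

theorem isRecord_one (hI : DefinableInduction peano M) {m x : M} (h : 1 < m) :
    IsRecord 1 m x ↔ x = 1 := by
  have hrem : ∀ {y v : M}, IsRemainder 1 m y v → v = y := fun hv =>
    hv.unique hI ⟨hv.1, hv.1, 0, by simp⟩
  constructor
  · rintro ⟨hx, v, hv, hmin⟩
    obtain rfl := hrem hv
    by_contra hne
    have h1 : 1 < v := lt_of_le_of_ne (one_le_of_ne_zero hI hx.ne') (Ne.symm hne)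
    exact lt_asymm h1 (hmin 1 1 one_pos h1 ⟨h, h, 0, by simp⟩)
  · rintro rfl
    exact ⟨one_pos, 1, ⟨h, h, 0, by simp⟩, fun y u hy hy1 _ =>
      absurd (one_le_of_ne_zero hI hy.ne') (not_le.2 hy1)⟩

end Records

/-! ### Prescribing the records modulo a number -/

section Squares

set_option linter.unusedSectionVars false

variable {M : Type*} [CommSemiring M] [LinearOrder M]

/-- Congruence modulo `n` in a semiring that need not have subtraction. -/
def Congruent (n x y : M) : Prop := ∃ u q p, x = n * q + u ∧ y = n * p + u

variable [IsStrictOrderedRing M] [CanonicallyOrderedAdd M]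

theorem congruent_iff_dvd {n x y : M} :
    Congruent n x y ↔ (DiffRing.of n : DiffRing M) ∣ DiffRing.of x - DiffRing.of y := by
  constructor
  · rintro ⟨u, q, p, rfl, rfl⟩
    exact ⟨DiffRing.of q - DiffRing.of p, by simp only [map_add, map_mul]; ring⟩
  · rintro ⟨d, hd⟩
    obtain ⟨c, rfl | rfl⟩ := d.exists_eq_or_neg
    · refine ⟨y, c, 0, DiffRing.of_injective ?_, by simp⟩
      simp only [map_add, map_mul]
      linear_combination hd
    · refine ⟨x, 0, c, by simp, DiffRing.of_injective ?_⟩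
      simp only [map_add, map_mul]
      linear_combination -hd

/-- Congruent numbers have the same remainder. -/
theorem Congruent.exists_remainder (hI : DefinableInduction peano M) {n x y : M} (hn : 0 < n)
    (h : Congruent n x y) : ∃ u < n, ∃ q p, x = n * q + u ∧ y = n * p + u := by
  obtain ⟨u, q, p, rfl, rfl⟩ := h
  obtain ⟨k, v, rfl, hv⟩ := exists_div_mod hI u hn
  exact ⟨v, hv, q + k, p + k, by ring, by ring⟩

theorem Congruent.eq_of_lt (hI : DefinableInduction peano M) {n x y : M} (h : Congruent n x y)
    (hx : x < n) (hy : y < n) : x = y := by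
  obtain ⟨u, hu, q, p, hq, hp⟩ := h.exists_remainder hI (pos_of_gt hx)
  have h1 := (div_mod_unique hI hx hu (q := 0) (q' := q) (by rw [mul_zero, zero_add]; exact hq)).2
  have h2 := (div_mod_unique hI hy hu (q := 0) (q' := p) (by rw [mul_zero, zero_add]; exact hp)).2
  rw [h1, h2]

theorem Congruent.trans {n x y z : M} (h : Congruent n x y) (h' : Congruent n y z) :
    Congruent n x z := by
  rw [congruent_iff_dvd] at *
  simpa using dvd_add h h'

theorem Congruent.symm {n x y : M} (h : Congruent n x y) : Congruent n y x := by
  obtain ⟨u, q, p, hq, hp⟩ := h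
  exact ⟨u, p, q, hp, hq⟩

/-- Four steps of the continued fraction add records with the residues `-1, w, 1, w`, and lead
back to a denominator congruent to `-1`. -/
theorem NeighbourFractions.exists_insert (hI : DefinableInduction peano M) {S r m r' m' w : M}
    (h : NeighbourFractions r m r' m') (hS : 1 < S) (hw : 0 < w) (hm : Congruent S (m + 1) 0) :
    ∃ r₁ m₁ r₁' m₁' x, NeighbourFractions r₁ m₁ r₁' m₁' ∧ Congruent S (m₁ + 1) 0 ∧
      Congruent S x w ∧ (∀ y, IsRecord r m y → IsRecord r₁ m₁ y) ∧ IsRecord r₁ m₁ x ∧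
      ∀ y, IsRecord r₁ m₁ y →
        IsRecord r m y ∨ Congruent S (y + 1) 0 ∨ Congruent S y 1 ∨ Congruent S y w := by
  -- The residue classes modulo `S` form a ring.
  let φ : M →+* DiffRing M ⧸ Ideal.span {(DiffRing.of S : DiffRing M)} :=
    (Ideal.Quotient.mk _).comp DiffRing.of
  have hφ : ∀ x y, Congruent S x y ↔ φ x = φ y := fun x y => by
    rw [congruent_iff_dvd, ← Ideal.mem_span_singleton, ← Ideal.Quotient.eq]
    rfl
  have hφS : φ S = 0 := by
    rw [← map_zero φ, ← hφ]
    exact ⟨0, 1, 0, by simp, by simp⟩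
  simp only [hφ, map_add, map_one, map_zero] at hm ⊢
  obtain ⟨R, rfl⟩ := exists_add_of_le hS.le
  have hR : 0 < R := pos_of_ne_zero fun h0 => by simp [h0] at hS
  replace hφS : 1 + φ R = 0 := by rw [← map_one φ, ← map_add]; exact hφS
  have hc : ∀ {x : M}, 0 < x → x < (1 + R) * x := fun {x} hx => by
    rw [add_mul, one_mul]
    exact lt_add_of_pos_right _ (mul_pos hR hx)
  obtain ⟨r₁, m₁, e₁, h₁, i₁⟩ := h.exists_step hI (c := R * (w + m')) (by
    calc m' < w + m' := lt_add_of_pos_left _ hw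
      _ ≤ R * (w + m') := le_mul_of_one_le_left zero_le (one_le_of_ne_zero hI hR.ne'))
  obtain ⟨r₂, m₂, e₂, h₂, i₂⟩ := h₁.exists_step hI (hc h₁.pos)
  obtain ⟨r₃, m₃, e₃, h₃, i₃⟩ := h₂.exists_step hI (c := 2 * w + (1 + R) * m₁)
    ((hc h₂.pos).trans_le le_add_self)
  obtain ⟨r₄, m₄, e₄, h₄, i₄⟩ := h₃.exists_step hI (hc h₃.pos)
  replace e₁ := congrArg φ e₁
  replace e₂ := congrArg φ e₂
  replace e₃ := congrArg φ e₃
  replace e₄ := congrArg φ e₄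
  simp only [map_add, map_mul, map_one, map_ofNat] at e₁ e₂ e₃ e₄
  have f₁ : φ m₁ = φ w := by
    linear_combination e₁ + φ R * (φ w + φ m') * hm - (φ w + φ m') * hφS
  have f₂ : φ m₂ = 1 := by linear_combination e₂ + φ m * φ m₁ * hφS - hm
  have f₃ : φ m₃ = φ w := by
    linear_combination e₃ + (2 * φ w + (1 + φ R) * φ m₁) * f₂ + φ m₁ * hφS - f₁
  have f₄ : φ m₄ + 1 = 0 := by linear_combination e₄ + φ m₂ * φ m₃ * hφS - f₂
  refine ⟨r₄, m₄, r₃, m₃, m₁, h₄, f₄, f₁, fun y hy => ?_, ?_, fun y hy => ?_⟩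
  · simp only [i₄, i₃, i₂, i₁, hy, true_or]
  · simp only [i₄, i₃, i₂, or_true, true_or]
  · simp only [i₄, i₃, i₂, i₁] at hy
    rcases hy with (((hy | rfl) | rfl) | rfl) | rfl
    exacts [Or.inl hy, Or.inr (Or.inl hm), Or.inr (Or.inr (Or.inr f₁)), Or.inr (Or.inr (Or.inl f₂)),
      Or.inr (Or.inr (Or.inr f₃))]

variable {n : ℕ}

theorem ParamDefinable.congruent {f g h : (Fin n → M) → M} (hf : ParamTerm peano f)
    (hg : ParamTerm peano g) (hh : ParamTerm peano h) :
    ParamDefinable peano fun xs => Congruent (f xs) (g xs) (h xs) :=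
  .ex (.ex (.ex (.and (.eq hg.init.init.init (.add (.mul hf.init.init.init (.var _)) (.var _)))
    (.eq hh.init.init.init (.add (.mul hf.init.init.init (.var _)) (.var _))))))

theorem ParamDefinable.isRemainder {f g h k : (Fin n → M) → M} (hf : ParamTerm peano f)
    (hg : ParamTerm peano g) (hh : ParamTerm peano h) (hk : ParamTerm peano k) :
    ParamDefinable peano fun xs => IsRemainder (f xs) (g xs) (h xs) (k xs) :=
  .and (.lt hh hg) (.and (.lt hk hg) (.ex (.eq (.mul hf.init hh.init)
    (.add (.mul hg.init (.var _)) hk.init))))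

theorem ParamDefinable.isRecord {f g h : (Fin n → M) → M} (hf : ParamTerm peano f)
    (hg : ParamTerm peano g) (hh : ParamTerm peano h) :
    ParamDefinable peano fun xs => IsRecord (f xs) (g xs) (h xs) :=
  .and (.lt (.param 0) hh) (.ex (.and (.isRemainder hf.init hg.init hh.init (.var _))
    (.all (.all (.imp (.lt (.param 0) (.var _)) (.imp (.lt (.var _) hh.init.init.init)
      (.imp (.isRemainder hf.init.init.init hg.init.init.init (.var _) (.var _))
        (.lt (.var _) (.var _)))))))))

/-- There are `r < m` for which the residues of the records modulo `S` are the squares of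
`1, …, T + 1`, and possibly `-1`. -/
theorem exists_isRecord_congruent_sq (hI : DefinableInduction peano M) {S : M} (hS : 2 < S)
    (T : M) :
    ∃ r m r' m', NeighbourFractions r m r' m' ∧ Congruent S (m + 1) 0 ∧
      (∀ t, 0 < t → t ≤ T + 1 → ∃ x, IsRecord r m x ∧ Congruent S x (t * t)) ∧
      ∀ x, IsRecord r m x →
        Congruent S (x + 1) 0 ∨ ∃ t, 0 < t ∧ t ≤ T + 1 ∧ Congruent S x (t * t) := by
  refine hI (fun T => ∃ r m r' m', NeighbourFractions r m r' m' ∧ Congruent S (m + 1) 0 ∧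
      (∀ t, 0 < t → t ≤ T + 1 → ∃ x, IsRecord r m x ∧ Congruent S x (t * t)) ∧
      ∀ x, IsRecord r m x →
        Congruent S (x + 1) 0 ∨ ∃ t, 0 < t ∧ t ≤ T + 1 ∧ Congruent S x (t * t)) ?_ ?_ ?_ T
  · have hdef : ∀ n (i j k l : Fin n), ParamDefinable peano fun xs : Fin n → M =>
        NeighbourFractions (xs i) (xs j) (xs k) (xs l) := by
      intro n i j k l
      have : (fun xs : Fin n → M => NeighbourFractions (xs i) (xs j) (xs k) (xs l)) =
          fun xs => xs i * xs l = xs k * xs j + 1 ∧ 0 < xs l ∧ 1 < xs j :=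
        funext fun xs => propext ⟨fun h => ⟨h.det, h.pos, h.one_lt⟩, fun h => ⟨h.1, h.2.1, h.2.2⟩⟩
      rw [this]
      exact .and (.eq (.mul (.var _) (.var _)) (.add (.mul (.var _) (.var _)) (.param _)))
        (.and (.lt (.param _) (.var _)) (.lt (.param _) (.var _)))
    exact .ex (.ex (.ex (.ex (.and (hdef _ _ _ _ _)
      (.and (.congruent (.param _) (.add (.var _) (.param _)) (.param _))
      (.and (.all (.imp (.lt (.param _) (.var _)) (.imp (.le (.var _) (.add (.var _) (.param _)))
        (.ex (.and (.isRecord (.var _) (.var _) (.var _))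
          (.congruent (.param _) (.var _) (.mul (.var _) (.var _))))))))
      (.all (.imp (.isRecord (.var _) (.var _) (.var _))
        (.or (.congruent (.param _) (.add (.var _) (.param _)) (.param _))
          (.ex (.and (.lt (.param _) (.var _)) (.and (.le (.var _) (.add (.var _) (.param _)))
            (.congruent (.param _) (.var _) (.mul (.var _) (.var _)))))))))))))))
  · obtain ⟨m, rfl⟩ := exists_add_of_le ((one_le_two (α := M)).trans hS.le)
    have hm : 1 < m := by
      rw [← one_add_one_eq_two] at hS
      exact lt_of_add_lt_add_left hS
    have hrec := fun x => isRecord_one hI (x := x) hm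
    refine ⟨1, m, 0, 1, neighbourFractions_one hm, ⟨0, 1, 0, by ring, by ring⟩, ?_, ?_⟩
    · intro t ht ht1
      obtain rfl : t = 1 := le_antisymm (by simpa using ht1) (one_le_of_ne_zero hI ht.ne')
      exact ⟨1, (hrec 1).2 rfl, 1, 0, 0, by simp, by simp⟩
    · intro x hx
      rw [hrec] at hx
      exact Or.inr ⟨1, one_pos, by simp, 1, 0, 0, by simp [hx], by simp⟩
  · rintro T ⟨r, m, r', m', h, hm, hsq, hrec⟩
    have hw : 0 < (T + 1 + 1) * (T + 1 + 1) := by positivity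
    obtain ⟨r₁, m₁, r₁', m₁', x, h₁, hm₁, hxw, hold, hx, hnew⟩ :=
      h.exists_insert hI (one_lt_two.trans hS) hw hm
    refine ⟨r₁, m₁, r₁', m₁', h₁, hm₁, fun t ht htT => ?_, fun y hy => ?_⟩
    · rcases htT.lt_or_eq with htT | rfl
      · obtain ⟨y, hy, hyt⟩ := hsq t ht ((lt_add_one_iff' hI).1 htT)
        exact ⟨y, hold y hy, hyt⟩
      · exact ⟨x, hx, hxw⟩
    · rcases hnew y hy with hy | hy | hy | hy
      · rcases hrec y hy with hy | ⟨t, ht, htT, hyt⟩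
        · exact Or.inl hy
        · exact Or.inr ⟨t, ht, htT.trans le_self_add, hyt⟩
      · exact Or.inl hy
      · exact Or.inr ⟨1, one_pos, le_add_self, by rwa [mul_one]⟩
      · exact Or.inr ⟨T + 1 + 1, by positivity, le_rfl, hy⟩

end Squares

/-! ### Definability by bounded formulas without parameters -/

section BoundedDefinability

set_option linter.unusedSectionVars false

variable {M : Type*} [CommSemiring M] [LinearOrder M] {k n : ℕ}

/-- The function `f` is the value of a term of `⟨M⁺, a, b⟩` without parameters. Its arguments are
the values of the free variables of a formula and the values of its quantified variables. -/
def BoundedTerm (a b : M) (f : (Fin k → M) → (Fin n → M) → M) : Prop :=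
  letI := scalarStructure ![a, b]
  ∃ t : (lin (Fin 2)).Term (Fin k ⊕ Fin n), ∀ v xs, t.realize (Sum.elim v xs) = f v xs

/-- The relation `P` is defined in `⟨M⁺, a, b⟩` by a `b`-bounded formula without parameters. -/
def BoundedDefinable (a b : M) (P : (Fin k → M) → (Fin n → M) → Prop) : Prop :=
  letI := scalarStructure ![a, b]
  ∃ φ : (lin (Fin 2)).BoundedFormula (Fin k) n, ScalarBounded 1 φ ∧
    ∀ v xs, φ.Realize v xs ↔ P v xs

variable {a b : M}

namespace BoundedTerm

variable {f g : (Fin k → M) → (Fin n → M) → M}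

theorem free (i : Fin k) : BoundedTerm a b fun v (_ : Fin n → M) => v i :=
  ⟨.var (.inl i), fun _ _ => rfl⟩

theorem var (i : Fin n) : BoundedTerm a b fun (_ : Fin k → M) xs => xs i :=
  ⟨.var (.inr i), fun _ _ => rfl⟩

theorem zero : BoundedTerm a b fun (_ : Fin k → M) (_ : Fin n → M) => (0 : M) :=
  ⟨tZero, fun _ _ => rfl⟩

theorem one : BoundedTerm a b fun (_ : Fin k → M) (_ : Fin n → M) => (1 : M) :=
  ⟨tOne, fun _ _ => rfl⟩

theorem add (hf : BoundedTerm a b f) (hg : BoundedTerm a b g) :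
    BoundedTerm a b fun v xs => f v xs + g v xs := by
  let := scalarStructure ![a, b]
  obtain ⟨s, hs⟩ := hf
  obtain ⟨t, ht⟩ := hg
  exact ⟨tAdd s t, fun v xs => by rw [(standardSymbols_lin ![a, b]).realize_add, hs, ht]⟩

theorem left_mul (hf : BoundedTerm a b f) : BoundedTerm a b fun v xs => a * f v xs := by
  let := scalarStructure ![a, b]
  obtain ⟨s, hs⟩ := hf
  exact ⟨tScalar 0 s, fun v xs => by rw [realize_tScalar, hs]; rfl⟩

theorem right_mul (hf : BoundedTerm a b f) : BoundedTerm a b fun v xs => b * f v xs := by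
  let := scalarStructure ![a, b]
  obtain ⟨s, hs⟩ := hf
  exact ⟨tScalar 1 s, fun v xs => by rw [realize_tScalar, hs]; rfl⟩

theorem left : BoundedTerm a b fun (_ : Fin k → M) (_ : Fin n → M) => a := by
  simpa only [mul_one] using (one (k := k) (n := n) (a := a) (b := b)).left_mul

theorem init (hf : BoundedTerm a b f) :
    BoundedTerm a b fun v (ys : Fin (n + 1) → M) => f v fun i => ys i.castSucc := by
  let := scalarStructure ![a, b]
  obtain ⟨t, ht⟩ := hf
  refine ⟨t.relabel (Sum.map id Fin.castSucc), fun v ys => ?_⟩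
  rw [Term.realize_relabel]
  refine Eq.trans ?_ (ht _ _)
  congr 1
  ext c
  rcases c with c | c <;> rfl

end BoundedTerm

namespace BoundedDefinable

variable {f g h : (Fin k → M) → (Fin n → M) → M} {P Q : (Fin k → M) → (Fin n → M) → Prop}

theorem of_iff (hP : BoundedDefinable a b P) (h : ∀ v xs, Q v xs ↔ P v xs) :
    BoundedDefinable a b Q := by
  obtain ⟨φ, hφ, hP⟩ := hP
  exact ⟨φ, hφ, fun v xs => (hP v xs).trans (h v xs).symm⟩

theorem imp (hP : BoundedDefinable a b P) (hQ : BoundedDefinable a b Q) :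
    BoundedDefinable a b fun v xs => P v xs → Q v xs := by
  let := scalarStructure ![a, b]
  obtain ⟨φ, hφ, hP⟩ := hP
  obtain ⟨ψ, hψ, hQ⟩ := hQ
  exact ⟨φ ⟹ ψ, hφ.imp hψ, fun v xs => by rw [BoundedFormula.realize_imp, hP, hQ]⟩

theorem not (hP : BoundedDefinable a b P) : BoundedDefinable a b fun v xs => ¬ P v xs :=
  imp (Q := fun _ _ => False) hP ⟨_, .falsum, fun _ _ => Iff.rfl⟩

theorem and (hP : BoundedDefinable a b P) (hQ : BoundedDefinable a b Q) :
    BoundedDefinable a b fun v xs => P v xs ∧ Q v xs :=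
  (hP.imp hQ.not).not.of_iff fun _ _ => by tauto

theorem or (hP : BoundedDefinable a b P) (hQ : BoundedDefinable a b Q) :
    BoundedDefinable a b fun v xs => P v xs ∨ Q v xs :=
  (hP.not.imp hQ).of_iff fun _ _ => by tauto

theorem eq (hf : BoundedTerm a b f) (hg : BoundedTerm a b g) :
    BoundedDefinable a b fun v xs => f v xs = g v xs := by
  obtain ⟨s, hs⟩ := hf
  obtain ⟨t, ht⟩ := hg
  exact ⟨_, .equal s t, fun v xs => iff_of_eq (congrArg₂ (· = ·) (hs v xs) (ht v xs))⟩

theorem le (hf : BoundedTerm a b f) (hg : BoundedTerm a b g) :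
    BoundedDefinable a b fun v xs => f v xs ≤ g v xs := by
  obtain ⟨s, hs⟩ := hf
  obtain ⟨t, ht⟩ := hg
  exact ⟨_, .rel (LeRel.le : (lin (Fin 2)).Relations 2) ![s, t],
    fun v xs => iff_of_eq (congrArg₂ (· ≤ ·) (hs v xs) (ht v xs))⟩

theorem lt (hf : BoundedTerm a b f) (hg : BoundedTerm a b g) :
    BoundedDefinable a b fun v xs => f v xs < g v xs :=
  (le hg hf).not.of_iff fun _ _ => not_le.symm

variable [IsStrictOrderedRing M] [CanonicallyOrderedAdd M]

/-- A universal quantifier whose counterexamples lie below the bound. -/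
theorem all {P : (Fin k → M) → (Fin n → M) → M → Prop}
    (hP : BoundedDefinable a b fun v (ys : Fin (n + 1) → M) =>
      P v (fun i => ys i.castSucc) (ys (Fin.last n)))
    (hb : ∀ v xs x, ¬ P v xs x → x < b) : BoundedDefinable a b fun v xs => ∀ x, P v xs x := by
  let := scalarStructure ![a, b]
  obtain ⟨φ, hφ, hP⟩ := hP
  refine ⟨_, hφ.ball, fun v xs => ?_⟩
  rw [BoundedFormula.realize_all]
  refine forall_congr' fun x => ?_
  rw [BoundedFormula.realize_imp, realize_bound, hP]
  simp only [Fin.snoc_castSucc, Fin.snoc_last]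
  exact ⟨fun h => by_contra fun hx => hx (h (hb v xs x hx)), fun h _ => h⟩

/-- An existential quantifier whose witnesses lie below the bound. -/
theorem ex {P : (Fin k → M) → (Fin n → M) → M → Prop}
    (hP : BoundedDefinable a b fun v (ys : Fin (n + 1) → M) =>
      P v (fun i => ys i.castSucc) (ys (Fin.last n)))
    (hb : ∀ v xs x, P v xs x → x < b) : BoundedDefinable a b fun v xs => ∃ x, P v xs x :=
  (all (P := fun v xs x => ¬ P v xs x) hP.not fun v xs x h => hb v xs x (not_not.1 h)).not.of_iff
    fun _ _ => by simp

theorem isRemainder (hab : a < b) (hf : BoundedTerm a b f) (hg : BoundedTerm a b g) :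
    BoundedDefinable a b fun v xs => IsRemainder b a (f v xs) (g v xs) := by
  refine of_iff (P := fun v xs => f v xs < a ∧ g v xs < a ∧
    ∃ q, f v xs < a ∧ b * f v xs = a * q + g v xs) ?_ fun v xs =>
      ⟨fun ⟨h1, h2, q, h3⟩ => ⟨h1, h2, q, h1, h3⟩, fun ⟨h1, h2, q, _, h3⟩ => ⟨h1, h2, q, h3⟩⟩
  refine .and (.lt hf .left) (.and (.lt hg .left) (.ex (.and (.lt hf.init .left)
    (.eq hf.init.right_mul (.add (.left_mul (.var _)) hg.init))) ?_))
  rintro v xs q ⟨h1, h2⟩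
  have h3 : a * q < a * b := by
    calc a * q ≤ a * q + g v xs := le_self_add
      _ = b * f v xs := h2.symm
      _ < b * a := mul_lt_mul_of_pos_left h1 (pos_of_gt hab)
      _ = a * b := mul_comm _ _
  exact lt_of_mul_lt_mul_left h3 zero_le

theorem isRecord (hab : a < b) (hf : BoundedTerm a b f) :
    BoundedDefinable a b fun v xs => IsRecord b a (f v xs) := by
  refine .and (.lt .zero hf) (.ex (.and (.isRemainder hab hf.init (.var _)) (.all (.all
    (.imp (.lt .zero (.var _)) (.imp (.lt (.var _) hf.init.init.init)
      (.imp (.isRemainder hab (.var _) (.var _)) (.lt (.var _) (.var _))))) ?_) ?_)) ?_)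
  · intro v xs u hu
    simp only [Classical.not_imp] at hu
    exact hu.2.2.1.2.1.trans hab
  · intro v xs y hy
    simp only [not_forall] at hy
    obtain ⟨u, -, -, h, -⟩ := hy
    exact h.1.trans hab
  · intro v xs u hu
    exact hu.1.2.1.trans hab

end BoundedDefinable

/-! ### Defining multiplication on a segment -/

variable [IsStrictOrderedRing M] [CanonicallyOrderedAdd M]

/-- If `b` is congruent modulo `a + 1` to a divisor `s` of `a + 1`, then this relation is the
congruence modulo `(a + 1) / s` for numbers up to `a`. -/
def ScaledCongruent (a b x y : M) : Prop := x ≤ a ∧ y ≤ a ∧ Congruent (a + 1) (b * x) (b * y)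

/-- `z` is a residue of a record that is not the residue of `a`. -/
def IsRecordResidue (a b z : M) : Prop :=
  (∀ y, y < z → ¬ ScaledCongruent a b y z) ∧ ¬ ScaledCongruent a b z a ∧
    ∃ x, IsRecord b a x ∧ ScaledCongruent a b x z

/-- A definition of `z = t ^ 2` for the case that the residues of records are squares. A square is
determined by its distance to the next one. -/
def IsCodedSquare (a b t z : M) : Prop :=
  (t = 0 ∧ z = 0) ∨ (IsRecordResidue a b z ∧ IsRecordResidue a b (z + (t + t + 1)) ∧
    ∀ y, z < y → y < z + (t + t + 1) → ¬ IsRecordResidue a b y)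

theorem IsRecordResidue.le {z : M} (h : IsRecordResidue a b z) : z ≤ a :=
  h.2.2.choose_spec.2.2.1

theorem IsCodedSquare.lt (hab : a < b) {t z : M} (h : IsCodedSquare a b t z) : z < b := by
  rcases h with ⟨-, rfl⟩ | h
  · exact pos_of_gt hab
  · exact h.1.le.trans_lt hab

namespace BoundedDefinable

variable {f g h : (Fin k → M) → (Fin n → M) → M}

theorem scaledCongruent (hI : DefinableInduction peano M) (hab : a < b) (hf : BoundedTerm a b f)
    (hg : BoundedTerm a b g) :
    BoundedDefinable a b fun v xs => ScaledCongruent a b (f v xs) (g v xs) := by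
  refine of_iff (P := fun v xs => f v xs ≤ a ∧ g v xs ≤ a ∧
    ∃ u, u ≤ a ∧ (∃ q, f v xs ≤ a ∧ b * f v xs = a * q + q + u) ∧
      ∃ q, g v xs ≤ a ∧ b * g v xs = a * q + q + u) ?_ fun v xs => ?_
  · have hq : ∀ {x q u : M}, x ≤ a → b * x = a * q + q + u → q < b := fun {x q u} hx hq => by
      have h3 : (a + 1) * q < (a + 1) * b := by
        calc (a + 1) * q ≤ a * q + q + u := by rw [add_mul, one_mul]; exact le_self_add
          _ = b * x := hq.symm
          _ ≤ b * a := by gcongr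
          _ < b * (a + 1) := mul_lt_mul_of_pos_left (lt_add_one a) (pos_of_gt hab)
          _ = (a + 1) * b := mul_comm _ _
      exact lt_of_mul_lt_mul_left h3 zero_le
    refine .and (.le hf .left) (.and (.le hg .left) (.ex (.and (.le (.var _) .left) (.and
      (.ex (.and (.le hf.init.init .left) (.eq hf.init.init.right_mul
        (.add (.add (.left_mul (.var _)) (.var _)) (.var _)))) ?_)
      (.ex (.and (.le hg.init.init .left) (.eq hg.init.init.right_mul
        (.add (.add (.left_mul (.var _)) (.var _)) (.var _)))) ?_))) ?_))
    · exact fun v xs q h => hq h.1 h.2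
    · exact fun v xs q h => hq h.1 h.2
    · exact fun v xs u h => h.1.trans_lt hab
  · have e : ∀ q u : M, a * q + q + u = (a + 1) * q + u := fun q u => by ring
    simp only [e]
    constructor
    · rintro ⟨h1, h2, h3⟩
      obtain ⟨u, hu, q, p, hq, hp⟩ := h3.exists_remainder hI (by positivity)
      exact ⟨h1, h2, u, (lt_add_one_iff' hI).1 hu, ⟨q, h1, hq⟩, p, h2, hp⟩
    · rintro ⟨h1, h2, u, -, ⟨q, -, hq⟩, p, -, hp⟩
      exact ⟨h1, h2, u, q, p, hq, hp⟩

theorem isRecordResidue (hI : DefinableInduction peano M) (hab : a < b)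
    (hf : BoundedTerm a b f) :
    BoundedDefinable a b fun v xs => IsRecordResidue a b (f v xs) := by
  refine .and (.all (.imp (.lt (.var _) hf.init) (.not (.scaledCongruent hI hab (.var _) hf.init)))
    ?_) (.and (.not (.scaledCongruent hI hab hf .left)) (.ex (.and (.isRecord hab (.var _))
      (.scaledCongruent hI hab (.var _) hf.init)) ?_))
  · intro v xs y hy
    simp only [Classical.not_imp, not_not] at hy
    exact hy.2.1.trans_lt hab
  · exact fun v xs x hx => hx.2.1.trans_lt hab

theorem isCodedSquare (hI : DefinableInduction peano M) (hab : a < b) (hf : BoundedTerm a b f)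
    (hg : BoundedTerm a b g) :
    BoundedDefinable a b fun v xs => IsCodedSquare a b (f v xs) (g v xs) := by
  refine .or (.and (.eq hf .zero) (.eq hg .zero)) (.and (.isRecordResidue hI hab hg)
    (.and (.isRecordResidue hI hab (.add hg (.add (.add hf hf) .one)))
      (.all (.imp (.lt hg.init (.var _)) (.imp (.lt (.var _)
        (.add hg.init (.add (.add hf.init hf.init) .one)))
          (.not (.isRecordResidue hI hab (.var _))))) ?_)))
  intro v xs y hy
  simp only [Classical.not_imp, not_not] at hy
  exact hy.2.2.le.trans_lt hab

end BoundedDefinable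

/-- There are scalars for which the residues of records are the squares of `1, …, T + 1`. -/
theorem exists_isRecordResidue_iff (hI : DefinableInduction peano M) (T : M) :
    ∃ a b : M, a < b ∧ ∀ z, IsRecordResidue a b z ↔ ∃ t, 0 < t ∧ t ≤ T + 1 ∧ z = t * t := by
  let S : M := (T + 1) * (T + 1) + 3
  have hS : 2 < S := lt_of_lt_of_le (by norm_num) le_add_self
  have hsq : ∀ {t : M}, t ≤ T + 1 → t * t + 1 < S := fun ht => by
    calc _ ≤ (T + 1) * (T + 1) + 1 := by gcongr
      _ < (T + 1) * (T + 1) + 3 := by gcongr; norm_num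
  obtain ⟨r, a, r', m', h, ha, hrec, hrec'⟩ := exists_isRecord_congruent_sq hI hS T
  obtain ⟨s, hs⟩ : ∃ s, a + 1 = S * s := by
    obtain ⟨u, q, p, hq, hp⟩ := ha
    rw [eq_comm, add_eq_zero] at hp
    exact ⟨q, by rw [hq, hp.2, add_zero]⟩
  have hs0 : s ≠ 0 := by
    rintro rfl
    simp at hs
  have hr0 : 0 < r := pos_of_ne_zero fun h0 => by
    have := h.det
    rw [h0, zero_mul, eq_comm, add_eq_zero] at this
    exact one_ne_zero this.2
  -- By the Chinese remainder theorem, `b` is `r` modulo `a` and `s` modulo `a + 1`.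
  let b := r * (a + 1) + s * (a * a)
  have hab : a < b := by
    calc a < 1 * (a + 1) := by rw [one_mul]; exact lt_add_one a
      _ ≤ r * (a + 1) := by gcongr; exact one_le_of_ne_zero hI hr0.ne'
      _ ≤ b := le_self_add
  have hb : b = r + a * (r + s * a) := by simp only [b]; ring
  have hrecb : ∀ x, IsRecord b a x ↔ IsRecord r a x := fun x => by
    rw [hb, isRecord_add_mul_iff hI]
  have hcong : ∀ x y, Congruent (a + 1) (b * x) (b * y) ↔ Congruent S x y := by
    intro x y
    have hs0' : (DiffRing.of s : DiffRing M) ≠ 0 := fun h => hs0 (DiffRing.of_eq_zero.1 h)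
    have e1 : (DiffRing.of (b * x) - DiffRing.of (b * y) : DiffRing M) =
        DiffRing.of s * (DiffRing.of x - DiffRing.of y) + DiffRing.of (a + 1) *
          ((DiffRing.of r + DiffRing.of s * (DiffRing.of a - 1)) *
            (DiffRing.of x - DiffRing.of y)) := by
      simp only [b, map_add, map_mul, map_one]
      ring
    rw [congruent_iff_dvd, congruent_iff_dvd, e1, dvd_add_left (dvd_mul_right _ _), hs, map_mul,
      mul_comm, mul_dvd_mul_iff_left hs0']
  have hSa : S ≤ a + 1 := by
    rw [hs]
    exact le_mul_of_one_le_right zero_le (one_le_of_ne_zero hI hs0)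
  have hsqa : ∀ {t : M}, t ≤ T + 1 → t * t ≤ a := fun ht =>
    (lt_of_add_lt_add_right ((hsq ht).trans_le hSa)).le
  have hneg : ∀ {x}, Congruent S x a ↔ Congruent S (x + 1) 0 := by
    intro x
    rw [congruent_iff_dvd] at ha ⊢
    rw [congruent_iff_dvd, ← dvd_add_left ha]
    refine iff_of_eq (congrArg _ ?_)
    simp only [map_add, map_one, map_zero]
    ring
  refine ⟨a, b, hab, fun z => ?_⟩
  simp only [IsRecordResidue, ScaledCongruent, hrecb, hcong]
  constructor
  · rintro ⟨hmin, hza, x, hx, -, hz, hxz⟩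
    rcases hrec' x hx with hx1 | ⟨t, ht, htT, hxt⟩
    · exact absurd ⟨hz, le_rfl, hxz.symm.trans (hneg.2 hx1)⟩ hza
    · refine ⟨t, ht, htT, ?_⟩
      have htz : Congruent S (t * t) z := hxt.symm.trans hxz
      have htS : t * t < S := (lt_add_one _).trans (hsq htT)
      rcases lt_or_ge (t * t) z with h1 | h1
      · exact absurd ⟨hsqa htT, hz, htz⟩ (hmin _ h1)
      · exact (htz.eq_of_lt hI htS (h1.trans_lt htS)).symm
  · rintro ⟨t, ht, htT, rfl⟩
    have htS : t * t < S := (lt_add_one _).trans (hsq htT)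
    refine ⟨fun y hy hc => hy.ne (hc.2.2.eq_of_lt hI (hy.trans htS) htS), fun hc => ?_, ?_⟩
    · have h1 := (hneg.1 hc.2.2).eq_of_lt hI (hsq htT) (pos_of_gt hS)
      exact absurd h1 (by positivity)
    · obtain ⟨x, hx, hxt⟩ := hrec t ht htT
      obtain ⟨v, hv, -⟩ := hx.2
      exact ⟨x, hx, hv.1.le, hsqa htT, hxt⟩

theorem isCodedSquare_iff (hI : DefinableInduction peano M) {T : M}
    (h : ∀ z, IsRecordResidue a b z ↔ ∃ t, 0 < t ∧ t ≤ T + 1 ∧ z = t * t) {t z : M} :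
    IsCodedSquare a b t z ↔ t ≤ T ∧ z = t * t := by
  have hsucc : ∀ t : M, t * t + (t + t + 1) = (t + 1) * (t + 1) := fun t => by ring
  have hlt : ∀ {x y : M}, x * x < y * y ↔ x < y := fun {x y} =>
    mul_self_lt_mul_self_iff zero_le zero_le |>.symm
  simp only [IsCodedSquare, h]
  constructor
  · rintro (⟨rfl, rfl⟩ | ⟨⟨s, hs, hsT, rfl⟩, ⟨s', hs', hsT', e⟩, hmin⟩)
    · simp
    · have h1 : s < s' := by
        rw [← hlt, ← e]
        exact lt_add_of_pos_right _ (by positivity)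
      have h2 : s' = s + 1 := by
        refine le_antisymm ?_ (add_one_le hI h1)
        by_contra! h3
        refine hmin ((s + 1) * (s + 1)) (hlt.2 (lt_add_one s)) (by rw [e]; exact hlt.2 h3)
          ⟨s + 1, by positivity, h3.le.trans hsT', rfl⟩
      rw [h2, ← hsucc] at e
      have h3 : t + t = s + s := add_right_cancel (add_left_cancel e)
      obtain rfl : t = s := by
        rw [← two_mul, ← two_mul] at h3
        exact mul_left_cancel₀ two_ne_zero h3
      rw [h2] at hsT'
      exact ⟨le_of_add_le_add_right hsT', rfl⟩
  · rintro ⟨htT, rfl⟩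
    rcases eq_or_ne t 0 with rfl | ht
    · simp
    · refine Or.inr ⟨⟨t, pos_of_ne_zero ht, htT.trans le_self_add, rfl⟩,
        ⟨t + 1, by positivity, by gcongr, hsucc t⟩, ?_⟩
      rintro y hy hy' ⟨u, hu, -, rfl⟩
      rw [hsucc, hlt] at hy'
      rw [hlt] at hy
      exact absurd ((lt_add_one_iff' hI).1 hy') (not_le.2 hy)

/-- Multiplication below any given element is definable by a bounded formula for suitable
scalars. -/
theorem exists_mulDefinableUpTo (hI : DefinableInduction peano M) (L : M) :
    ∃ a b : M, a < b ∧ MulDefinableUpTo L a b := by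
  obtain ⟨a, b, hab, h⟩ := exists_isRecordResidue_iff hI (L + L)
  have hsq := fun {t z : M} => isCodedSquare_iff hI h (t := t) (z := z)
  have hle : ∀ x : M, (∃ w, IsCodedSquare a b (x + x) w) ↔ x ≤ L := by
    intro x
    simp only [hsq, exists_and_left, exists_eq, and_true]
    refine ⟨fun hx => ?_, fun hx => by gcongr⟩
    by_contra! h1
    exact absurd hx (not_le.2 (add_lt_add h1 h1))
  have hdef : BoundedDefinable a b fun (v : Fin 3 → M) (_ : Fin 0 → M) =>
      (∃ w, IsCodedSquare a b (v 0 + v 0) w) ∧ (∃ w, IsCodedSquare a b (v 1 + v 1) w) ∧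
        ∃ p, IsCodedSquare a b (v 0) p ∧ ∃ q, IsCodedSquare a b (v 1) q ∧
          ∃ r, IsCodedSquare a b (v 0 + v 1) r ∧ r = p + q + (v 2 + v 2) := by
    have hs : ∀ {n : ℕ} {f g : (Fin 3 → M) → (Fin n → M) → M}, BoundedTerm a b f →
        BoundedTerm a b g → BoundedDefinable a b fun v xs => IsCodedSquare a b (f v xs) (g v xs) :=
      BoundedDefinable.isCodedSquare hI hab
    exact .and (.ex (hs (.add (.free _) (.free _)) (.var _)) fun _ _ _ h => h.lt hab)
      (.and (.ex (hs (.add (.free _) (.free _)) (.var _)) fun _ _ _ h => h.lt hab)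
      (.ex (.and (hs (.free _) (.var _)) (.ex (.and (hs (.free _) (.var _))
        (.ex (.and (hs (.add (.free _) (.free _)) (.var _))
          (.eq (.var _) (.add (.add (.var _) (.var _)) (.add (.free _) (.free _)))))
        fun _ _ _ h => h.1.lt hab)) fun _ _ _ h => h.1.lt hab)) fun _ _ _ h => h.1.lt hab))
  obtain ⟨φ, hφ, hdef⟩ := hdef
  refine ⟨a, b, hab, φ, hφ, fun x y z => (hdef ![x, y, z] default).trans ?_⟩
  change (∃ w, IsCodedSquare a b (x + x) w) ∧ (∃ w, IsCodedSquare a b (y + y) w) ∧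
    (∃ p, IsCodedSquare a b x p ∧ ∃ q, IsCodedSquare a b y q ∧
      ∃ r, IsCodedSquare a b (x + y) r ∧ r = p + q + (z + z)) ↔ _
  rw [hle, hle]
  refine and_congr_right fun hx => and_congr_right fun hy => ?_
  have hxL : x ≤ L + L := hx.trans le_self_add
  have hyL : y ≤ L + L := hy.trans le_self_add
  have hxy : x + y ≤ L + L := add_le_add hx hy
  simp only [hsq, hxL, hyL, hxy, true_and, exists_eq_left]
  -- The polarization identity `(x + y) ^ 2 = x ^ 2 + y ^ 2 + 2 x y`.
  rw [show (x + y) * (x + y) = x * x + y * y + (x * y + x * y) by ring, add_right_inj, ← two_mul,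
    ← two_mul, mul_right_inj' two_ne_zero, eq_comm]

end BoundedDefinability

end LinArith

theorem theorem3p1 {M : Type*} [Zero M] [One M] [Add M] [Mul M] [LE M]
    (hPA : M ⊨ LinArith.PA) (hM : ∃ x : M, LinArith.IsNonstandard x) (L : M) :
    (∃ a b : M, (a ≤ b ∧ a ≠ b) ∧ LinArith.ModelsTwo a b (LinArith.LA (Fin 2)) ∧
      LinArith.MulDefinableUpTo L a b) ∧
    (LinArith.IsNonstandard L → {x : M | x ≤ L}.Infinite ∧
      ∀ a b : M, (a ≤ b ∧ a ≠ b) → LinArith.MulDefinableUpTo L a b →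
        LinArith.ModelsTwo a b (LinArith.LAStrict (Fin 2))) := by
  have h := LinArith.PeanoAxioms.of_models hPA
  let := h.commSemiring
  let := h.linearOrder
  have := h.isStrictOrderedRing
  have := h.canonicallyOrderedAdd
  have hI := h.ind
  refine ⟨?_, fun hL => ⟨?_, fun a b _ => LinArith.models_LAStrict hI hM hL⟩⟩
  · obtain ⟨a, b, hab, hmul⟩ := LinArith.exists_mulDefinableUpTo hI L
    exact ⟨a, b, ⟨hab.le, hab.ne⟩, LinArith.models_LA hI ![a, b], hmul⟩
  · exact Set.infinite_of_injective_forall_mem Nat.cast_injective fun n => (hL.natCast_lt hI n).le
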